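/- Let $X$ be a finite set with $n$ elements, let $W$ be a non-trivial element of the free group on $X$ (a non-trivial freely reduced word), let $p>1$ be an integer, and let $A=PSL(2,\mathbb C)=SL(2,\mathbb C)/\{\pm I\}$. Consider the groups given by the presentations $$G=\langle X,y\,;\,W(X)=y^p\rangle,\qquad G'=\langle X\,;\,W(X)=1\rangle,$$ where $y\notin X$ is an additional generator. For a group $H$ generated by a finite set $Y$, let $R_A(H)=\mathrm{Hom}(H,A)$ be its representation variety, that is, $\mathrm{Hom}(H,A)$ regarded via $\rho\mapsto(\rho(t))_{t\in Y}$ as a Zariski closed subset of the affine variety $A^{Y}$ (with its Zariski topology; it need not be irreducible), and let $\dim$ denote the Krull dimension. Then: 1. $\dim R_A(G)=\max\{3n,\ \dim R_A(G')+2\}\le 3n+1$. 2. If $\dim R_A(G')+2\ge 3n$, then $R_A(G)$ is reducible, i.e. it is the union of two proper Zariski closed subsets. -/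

import Mathlib

noncomputable section

/-- `PSL(2, ℂ)`, the quotient of `SL(2, ℂ)` by its center `{1, -1}`. -/
abbrev PSL2C : Type := Matrix.ProjectiveSpecialLinearGroup (Fin 2) ℂ

/-- The projection `SL(2, ℂ) → PSL(2, ℂ)`. -/
def toPSL2C : Matrix.SpecialLinearGroup (Fin 2) ℂ →* PSL2C :=
  QuotientGroup.mk' (Subgroup.center (Matrix.SpecialLinearGroup (Fin 2) ℂ))

/-- The coordinate algebra of the affine variety `PSL(2, ℂ)^X`, where `X` is finite: the functions
whose pullback to `SL(2, ℂ)^X` is a polynomial in the matrix entries. (The affine variety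
`PSL(2, ℂ)^X` is the quotient of `SL(2, ℂ)^X` by the finite group `{1, -1}^X`, so its regular
functions are the regular functions on `SL(2, ℂ)^X` that are constant on the fibres.) -/
def coordinateAlgebraPSL2C (X : Type*) : Subalgebra ℂ ((X → PSL2C) → ℂ) where
  carrier := {f | ∃ P : MvPolynomial (X × Fin 2 × Fin 2) ℂ,
    ∀ g : X → Matrix.SpecialLinearGroup (Fin 2) ℂ,
      f (fun x => toPSL2C (g x)) = MvPolynomial.eval (fun i => (g i.1).1 i.2.1 i.2.2) P}
  mul_mem' := by
    rintro f₁ f₂ ⟨P₁, h₁⟩ ⟨P₂, h₂⟩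
    exact ⟨P₁ * P₂, fun g => by simp [h₁ g, h₂ g]⟩
  add_mem' := by
    rintro f₁ f₂ ⟨P₁, h₁⟩ ⟨P₂, h₂⟩
    exact ⟨P₁ + P₂, fun g => by simp [h₁ g, h₂ g]⟩
  algebraMap_mem' := fun c => ⟨MvPolynomial.C c, fun g => by simp⟩

/-- The Zariski topology on a set `S` with respect to an algebra `O` of complex functions on `S`:
the closed sets are the sets of common zeros of families of functions in `O`. -/
@[reducible]
def zariskiTopology {S : Type*} (O : Subalgebra ℂ (S → ℂ)) : TopologicalSpace S :=
  TopologicalSpace.ofClosed {Z | ∃ F ⊆ (O : Set (S → ℂ)), Z = {s | ∀ f ∈ F, f s = 0}}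
    ⟨{1}, by simp [O.one_mem], by simp⟩
    (by
      intro A hA
      refine ⟨{f | f ∈ O ∧ ∃ Z ∈ A, ∀ s ∈ Z, f s = 0}, fun f hf => hf.1, ?_⟩
      ext s
      simp only [Set.mem_sInter, Set.mem_ofPred_eq]
      constructor
      · rintro hs f ⟨-, Z, hZ, hf⟩
        exact hf s (hs Z hZ)
      · intro hs Z hZ
        obtain ⟨F, hF, rfl⟩ := hA hZ
        exact fun f hf => hs f ⟨hF hf, _, hZ, fun t ht => ht f hf⟩)
    (by
      rintro _ ⟨F₁, h₁, rfl⟩ _ ⟨F₂, h₂, rfl⟩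
      refine ⟨{h | ∃ f₁ ∈ F₁, ∃ f₂ ∈ F₂, h = f₁ * f₂}, ?_, ?_⟩
      · rintro _ ⟨f₁, hf₁, f₂, hf₂, rfl⟩
        exact O.mul_mem (h₁ hf₁) (h₂ hf₂)
      · ext s
        constructor
        · rintro (hs | hs) _ ⟨f₁, hf₁, f₂, hf₂, rfl⟩
          · simp [hs f₁ hf₁]
          · simp [hs f₂ hf₂]
        · intro hs
          by_contra hcon
          simp only [Set.mem_union, Set.mem_ofPred_eq, not_or, not_forall] at hcon
          obtain ⟨⟨f₁, hf₁, hn₁⟩, f₂, hf₂, hn₂⟩ := hcon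
          have := hs _ ⟨f₁, hf₁, f₂, hf₂, rfl⟩
          simp [hn₁, hn₂] at this)

/-- The representation variety `Hom(G, PSL(2, ℂ))` of the group `G = ⟨X ; rels⟩`. -/
def RepVariety {X : Type*} (rels : Set (FreeGroup X)) : Type _ :=
  PresentedGroup rels →* PSL2C

/-- The Zariski topology on `Hom(G, PSL(2, ℂ))`: the subspace topology for the embedding
`ρ ↦ (ρ x)_{x ∈ X}` into the affine variety `PSL(2, ℂ)^X`. -/
instance repVarietyTopology {X : Type*} (rels : Set (FreeGroup X)) : TopologicalSpace (RepVariety rels) :=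
  TopologicalSpace.induced
    (fun (ρ : PresentedGroup rels →* PSL2C) (x : X) => ρ (PresentedGroup.of x))
    (zariskiTopology (coordinateAlgebraPSL2C X))

/-- The relators of `⟨X, y ; W(X) = y ^ p⟩`. The generating set is `Option X`, where `some x` is
the generator `x ∈ X` and `none` is the additional generator `y`. -/
def pinchedRelators {X : Type*} (W : FreeGroup X) (p : ℕ) : Set (FreeGroup (Option X)) :=
  {FreeGroup.map some W * (FreeGroup.of none ^ p)⁻¹}

end

/-! A family `g` of matrices in `SL(2, D)` over a domain `D` that satisfies the relators up to sign
is the generic point of an irreducible closed set of representations, whose dimension is the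
transcendence degree of the algebra generated by the entries of `g`; every irreducible closed set
has such a generic point over an algebraically closed field.

For the relator `W(X) = y ^ p` such a family is a family `g` on `X` together with a matrix `h` with
`W(g) = ± h ^ p`. If `W(g) ≠ ± 1`, then `h` commutes with `W(g)` and is algebraic over the entries
of `g`, so the dimension is at most `3n`, and this is attained for a generic `g` and a `p`-th root
of `W(g)`. If `W(g) = ± 1`, then `h` has finite order, so its trace is a constant and `h` adds at
most two parameters; both are attained when `h` is the generic conjugate of `diag(ζ, ζ⁻¹)` with
`ζ ^ p = -1` and `ζ ≠ ± 1`. A generic `g` does not satisfy `W(g) = ± 1`, because `W` has values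
other than `± 1` on diagonalizable matrices with generic axes.

The square of the trace of `y` is constant on the closed sets of the second kind but not on the
whole representation variety, which contains the trivial representation. Hence these sets are
proper, and they rule out irreducibility as soon as they have the full dimension. -/

open scoped MatrixGroups

theorem krullDim_eq_of_strictMono_of_lift {α β : Type*} [Preorder α] [Preorder β] (f : α → β)
    (hf : StrictMono f) (hsurj : Function.Surjective f)
    (hlift : ∀ a b, f a < b → ∃ a', a < a' ∧ f a' = b) : Order.krullDim α = Order.krullDim β := by
  simp only [Order.krullDim_eq_iSup_coheight, Order.coheight_eq_of_strictMono f hf hlift]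
  exact hsurj.iSup_comp (fun b => (Order.coheight b : WithBot ℕ∞))

theorem ringKrullDim_eq_of_isIntegral_of_injective {R S : Type*} [CommRing R] [CommRing S]
    [Algebra R S] [Algebra.IsIntegral R S] (hinj : Function.Injective (algebraMap R S)) :
    ringKrullDim S = ringKrullDim R := by
  refine krullDim_eq_of_strictMono_of_lift (PrimeSpectrum.comap (algebraMap R S)) ?_ ?_ ?_
  · intro P Q hPQ
    obtain ⟨x, hx⟩ := Set.exists_of_ssubset hPQ
    exact Ideal.comap_lt_comap_of_integral_mem_sdiff hPQ.le hx (Algebra.IsIntegral.isIntegral _)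
  · intro P
    have hker : (⊥ : Ideal S).comap (algebraMap R S) ≤ P.asIdeal := by
      rw [← RingHom.ker_eq_comap_bot, (RingHom.injective_iff_ker_eq_bot _).mp hinj]
      exact bot_le
    obtain ⟨Q, -, hQ, hQP⟩ := Ideal.exists_ideal_over_prime_of_isIntegral P.asIdeal ⊥ hker
    exact ⟨⟨Q, hQ⟩, PrimeSpectrum.ext hQP⟩
  · intro P Q hPQ
    obtain ⟨Q', hle, hQ', hQ⟩ := Ideal.exists_ideal_over_prime_of_isIntegral Q.asIdeal P.asIdeal
      hPQ.le
    refine ⟨⟨Q', hQ'⟩, lt_of_le_of_ne hle ?_, PrimeSpectrum.ext hQ⟩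
    rintro rfl
    exact hPQ.ne (PrimeSpectrum.ext hQ)

theorem ringKrullDim_eq_toENat_trdeg (k A : Type*) [Field k] [CommRing A] [IsDomain A]
    [Algebra k A] [Algebra.FiniteType k A] :
    ringKrullDim A = (Cardinal.toENat (Algebra.trdeg k A) : ℕ∞) := by
  obtain ⟨s, φ, hinj, hint⟩ := exists_integral_inj_algHom_of_fg k A
  algebraize [φ.toRingHom]
  have : IsScalarTower k (MvPolynomial (Fin s) k) A :=
    .of_algebraMap_eq' φ.comp_algebraMap.symm
  have : Algebra.IsIntegral (MvPolynomial (Fin s) k) A := ⟨hint⟩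
  have : FaithfulSMul (MvPolynomial (Fin s) k) A :=
    (faithfulSMul_iff_algebraMap_injective _ _).mpr hinj
  have htrdeg : Algebra.trdeg k A = s := by
    have h := lift_trdeg_add_eq k (MvPolynomial (Fin s) k) A
    rw [trdeg_eq_zero (R := MvPolynomial (Fin s) k) (A := A)] at h
    apply Cardinal.lift_injective
    rw [← h]
    simp
  rw [ringKrullDim_eq_of_isIntegral_of_injective (R := MvPolynomial (Fin s) k) hinj, htrdeg,
    MvPolynomial.ringKrullDim_of_isNoetherianRing, ringKrullDim_eq_zero_of_field]
  simp

section TranscendenceRank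

open AlgebraicIndependent (matroid)

variable {k A B : Type*} [Field k] [CommRing A] [IsDomain A] [CommRing B] [IsDomain B]
  [Algebra k A] [Algebra k B]

theorem matroid_comap_of_injective (f : A →ₐ[k] B) (hf : Function.Injective f) :
    (matroid k B).comap f = matroid k A := by
  refine Matroid.ext_indep rfl fun I _ => ?_
  rw [Matroid.comap_indep_iff, AlgebraicIndependent.matroid_indep_iff,
    AlgebraicIndependent.matroid_indep_iff, and_iff_left hf.injOn]
  exact (algebraicIndependent_image hf.injOn).symm.trans (f.algebraicIndependent_iff hf)

theorem ringKrullDim_eq_eRk_range [Algebra.FiniteType k A] (f : A →ₐ[k] B)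
    (hf : Function.Injective f) : ringKrullDim A = ((matroid k B).eRk (Set.range f) : ℕ∞) := by
  rw [ringKrullDim_eq_toENat_trdeg k A, ← AlgebraicIndependent.matroid_cRank_eq,
    Matroid.toENat_cRank_eq, ← matroid_comap_of_injective f hf, ← Matroid.eRk_ground,
    Matroid.eRk_comap]
  simp

theorem ringKrullDim_quotient_ker {A : Type*} [CommRing A] [Algebra k A] [Algebra.FiniteType k A]
    (f : A →ₐ[k] B) :
    ringKrullDim (A ⧸ RingHom.ker f) = ((matroid k B).eRk (Set.range f) : ℕ∞) := by
  have := RingHom.ker_isPrime f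
  rw [ringKrullDim_eq_eRk_range (Ideal.kerLiftAlg f) (Ideal.kerLiftAlg_injective f),
    ← Ideal.Quotient.mk_surjective.range_comp]
  rfl

theorem eRk_adjoin (s : Set B) : (matroid k B).eRk (Algebra.adjoin k s) = (matroid k B).eRk s := by
  refine le_antisymm ?_ ((matroid k B).eRk_mono Algebra.subset_adjoin)
  rw [← (matroid k B).eRk_closure_eq s]
  refine (matroid k B).eRk_mono fun x hx => ?_
  rw [AlgebraicIndependent.matroid_closure_eq]
  exact isAlgebraic_algebraMap (⟨x, hx⟩ : Algebra.adjoin k s)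
theorem eRk_le_eRk_of_isAlgebraic {s t : Set A}
    (h : ∀ a ∈ s, IsAlgebraic (Algebra.adjoin k t) a) :
    (matroid k A).eRk s ≤ (matroid k A).eRk t := by
  rw [← (matroid k A).eRk_closure_eq t, AlgebraicIndependent.matroid_closure_eq]
  exact (matroid k A).eRk_mono h

theorem isAlgebraic_adjoin_of_mem {s : Set A} {a : A} (ha : a ∈ s) :
    IsAlgebraic (Algebra.adjoin k s) a :=
  isAlgebraic_algebraMap (⟨a, Algebra.subset_adjoin ha⟩ : Algebra.adjoin k s)

theorem encard_range_le_card {α ι : Type*} (v : ι → α) : (Set.range v).encard ≤ ENat.card ι := by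
  rw [← Set.image_univ, ← Set.encard_univ]
  exact Set.encard_image_le v _

theorem eRk_range_of_algebraicIndependent {ι : Type*} {v : ι → A} (hv : AlgebraicIndependent k v) :
    (matroid k A).eRk (Set.range v) = ENat.card ι := by
  rw [Matroid.Indep.eRk_eq_encard hv.to_subtype_range]
  exact le_antisymm (encard_range_le_card v) hv.injective.encard_range

theorem algebraicIndependent_of_card_le_eRk {ι : Type*} [Finite ι] {v : ι → A}
    (hv : ENat.card ι ≤ (matroid k A).eRk (Set.range v)) : AlgebraicIndependent k v := by
  have h_card : (Set.range v).encard = ENat.card ι :=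
    le_antisymm (encard_range_le_card v) (hv.trans ((matroid k A).eRk_le_encard _))
  have h_inj : Function.Injective v := by
    rw [← Set.injOn_univ]
    refine Set.injOn_of_ncard_image_eq ?_
    rw [Set.image_univ, Set.ncard, h_card, Set.ncard, Set.encard_univ]
  refine (algebraicIndependent_subtype_range h_inj).mp ?_
  refine Matroid.IsRkFinite.indep_of_encard_le_eRk ?_ (h_card.trans_le hv)
  exact (matroid k A).isRkFinite_of_finite (Set.finite_range v)

theorem eRk_add_card_le_eRk_image_C_union_range_X (σ : Type*) (s : Set A) :
    (matroid k A).eRk s + ENat.card σ ≤ (matroid k (MvPolynomial σ A)).eRk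
      (MvPolynomial.C '' s ∪ Set.range MvPolynomial.X) := by
  obtain ⟨I, hI⟩ := (matroid k A).exists_isBasis s
  have h_indep := (AlgebraicIndependent.matroid_indep_iff.mp hI.indep).sumElim_comp
    (MvPolynomial.algebraicIndependent_X σ A)
  rw [← hI.encard_eq_eRk, ← ENat.card_coe_set_eq, add_comm, ← ENat.card_sum,
    ← eRk_range_of_algebraicIndependent h_indep]
  refine (matroid k (MvPolynomial σ A)).eRk_mono ?_
  rintro _ ⟨i | i, rfl⟩
  · exact Or.inr ⟨i, rfl⟩
  · exact Or.inl ⟨i, hI.subset i.2, rfl⟩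

end TranscendenceRank

section CoordinateRing

theorem map_freeGroupLift {Y G H : Type*} [Group G] [Group H] (φ : G →* H) (g : Y → G)
    (w : FreeGroup Y) : φ (FreeGroup.lift g w) = FreeGroup.lift (fun y => φ (g y)) w := by
  have h : φ.comp (FreeGroup.lift g) = FreeGroup.lift (fun y => φ (g y)) := by
    ext y
    simp
  exact DFunLike.congr_fun h w

theorem eq_one_or_eq_neg_one_iff {D : Type*} [CommRing D] [NoZeroDivisors D] (M : SL(2, D)) :
    M = 1 ∨ M = -1 ↔ M 0 1 = 0 ∧ M 1 0 = 0 ∧ M 0 0 - M 1 1 = 0 := by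
  constructor
  · rintro (rfl | rfl) <;> simp
  · rintro ⟨h01, h10, hdiag⟩
    have hdet : M 1 1 * M 1 1 = 1 := by
      have h := M.det_coe
      rwa [Matrix.det_fin_two, h01, sub_eq_zero.mp hdiag, zero_mul, sub_zero] at h
    refine (mul_self_eq_one_iff.mp hdet).imp (fun h => ?_) fun h => ?_ <;>
    · ext i j
      fin_cases i <;> fin_cases j <;> simp [h01, h10, h, sub_eq_zero.mp hdiag]

open MvPolynomial

variable (k Y : Type*) [CommRing k]

/-- The coordinate ring of `SL(2)^Y` over `k`: its `k`-algebra maps to `D` are the families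
`Y → SL(2, D)`. -/
abbrev SLCoordRing : Type _ :=
  MvPolynomial (Y × Fin 2 × Fin 2) k ⧸ Ideal.span (Set.range fun y : Y =>
    (X (y, 0, 0) * X (y, 1, 1) - X (y, 0, 1) * X (y, 1, 0) - 1 :
      MvPolynomial (Y × Fin 2 × Fin 2) k))

/-- The universal family of matrices of determinant one. -/
noncomputable def genericSL (y : Y) : SL(2, SLCoordRing k Y) :=
  ⟨Matrix.of fun i j => Ideal.Quotient.mk _ (X (y, i, j)), by
    rw [Matrix.det_fin_two, ← sub_eq_zero]
    exact Ideal.Quotient.eq_zero_iff_mem.mpr (Ideal.subset_span ⟨y, rfl⟩)⟩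

variable {Y} {D D' : Type*} [CommRing D] [Algebra k D] [CommRing D'] [Algebra k D']

/-- The `k`-algebra map on the coordinate ring of `SL(2)^Y` that classifies the family `g`. -/
noncomputable def coordHom (g : Y → SL(2, D)) : SLCoordRing k Y →ₐ[k] D :=
  Ideal.Quotient.liftₐ _ (aeval fun i => g i.1 i.2.1 i.2.2) fun f hf => by
    refine (RingHom.mem_ker (f := (aeval fun i => g i.1 i.2.1 i.2.2 :
      MvPolynomial (Y × Fin 2 × Fin 2) k →ₐ[k] D))).mp (Ideal.span_le.mpr ?_ hf)
    rintro _ ⟨y, rfl⟩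
    have hdet := (g y).det_coe
    rw [Matrix.det_fin_two] at hdet
    simp [RingHom.mem_ker, hdet]

variable {k}

theorem coordHom_mk (g : Y → SL(2, D)) (q : MvPolynomial (Y × Fin 2 × Fin 2) k) :
    coordHom k g (Ideal.Quotient.mk _ q) = aeval (fun i => g i.1 i.2.1 i.2.2) q :=
  rfl

@[simp]
theorem coordHom_genericSL (g : Y → SL(2, D)) (y : Y) (i j : Fin 2) :
    coordHom k g (genericSL k Y y i j) = g y i j :=
  (coordHom_mk g _).trans (aeval_X _ _)

theorem SLCoordRing.algHom_ext {φ ψ : SLCoordRing k Y →ₐ[k] D}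
    (h : ∀ y i j, φ (genericSL k Y y i j) = ψ (genericSL k Y y i j)) : φ = ψ :=
  Ideal.Quotient.algHom_ext _ (MvPolynomial.algHom_ext fun _ => h _ _ _)

theorem map_coordHom_genericSL (g : Y → SL(2, D)) (y : Y) :
    Matrix.SpecialLinearGroup.map (coordHom k g : SLCoordRing k Y →+* D) (genericSL k Y y) =
      g y := by
  ext i j
  exact coordHom_genericSL g y i j

theorem coordHom_map_genericSL (φ : SLCoordRing k Y →ₐ[k] D) :
    coordHom k (fun y => Matrix.SpecialLinearGroup.map (φ : SLCoordRing k Y →+* D)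
      (genericSL k Y y)) = φ :=
  SLCoordRing.algHom_ext fun y i j => coordHom_genericSL _ y i j

theorem comp_coordHom (φ : D →ₐ[k] D') (g : Y → SL(2, D)) :
    φ.comp (coordHom k g) =
      coordHom k (fun y => Matrix.SpecialLinearGroup.map (φ : D →+* D') (g y)) :=
  SLCoordRing.algHom_ext fun y i j => by simp

theorem coordHom_lift_genericSL (g : Y → SL(2, D)) (w : FreeGroup Y) (i j : Fin 2) :
    coordHom k g (FreeGroup.lift (genericSL k Y) w i j) = FreeGroup.lift g w i j := by
  have h : Matrix.SpecialLinearGroup.map (coordHom k g : SLCoordRing k Y →+* D)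
      (FreeGroup.lift (genericSL k Y) w) = FreeGroup.lift g w := by
    rw [map_freeGroupLift, funext (map_coordHom_genericSL g)]
  rw [← h]
  rfl

/-- The set of all matrix entries of the members of the family `g`. -/
def entrySet (g : Y → SL(2, D)) : Set D :=
  Set.range fun i : Y × Fin 2 × Fin 2 => g i.1 i.2.1 i.2.2

theorem range_coordHom (g : Y → SL(2, D)) :
    (coordHom k g).range = Algebra.adjoin k (entrySet g) := by
  rw [entrySet, Algebra.adjoin_range_eq_range_aeval]
  ext x
  exact ⟨fun ⟨q, hq⟩ => (Ideal.Quotient.mk_surjective q).imp fun r hr => by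
    rw [← hq, ← hr]; rfl, fun ⟨q, hq⟩ => ⟨Ideal.Quotient.mk _ q, hq⟩⟩

/-- The family `g` defines a homomorphism from `⟨Y ; rels⟩` to `SL(2, D) / {±1}`. -/
def IsProjectiveRep (rels : Set (FreeGroup Y)) (g : Y → SL(2, D)) : Prop :=
  ∀ w ∈ rels, FreeGroup.lift g w = 1 ∨ FreeGroup.lift g w = -1

variable (k)

/-- The equations on families in `SL(2)^Y` expressing that every relator takes a value `±1`. -/
noncomputable def repIdeal (rels : Set (FreeGroup Y)) : Ideal (SLCoordRing k Y) :=
  ⨆ w ∈ rels, Ideal.span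
    {FreeGroup.lift (genericSL k Y) w 0 1, FreeGroup.lift (genericSL k Y) w 1 0,
      FreeGroup.lift (genericSL k Y) w 0 0 - FreeGroup.lift (genericSL k Y) w 1 1}

variable {k}

theorem repIdeal_le_ker_coordHom_iff [NoZeroDivisors D] (rels : Set (FreeGroup Y))
    (g : Y → SL(2, D)) :
    repIdeal k rels ≤ RingHom.ker (coordHom k g) ↔ IsProjectiveRep rels g := by
  rw [repIdeal, iSup₂_le_iff]
  refine forall₂_congr fun w _ => ?_
  rw [eq_one_or_eq_neg_one_iff, Ideal.span_le]
  simp only [Set.insert_subset_iff, Set.singleton_subset_iff, SetLike.mem_coe, RingHom.mem_ker,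
    map_sub, coordHom_lift_genericSL]

end CoordinateRing

theorem toPSL2C_eq_iff (a b : SL(2, ℂ)) : toPSL2C a = toPSL2C b ↔ b = a ∨ b = -a := by
  have hcenter (c : SL(2, ℂ)) : c ∈ Subgroup.center SL(2, ℂ) ↔ c = 1 ∨ c = -1 := by
    rw [Matrix.SpecialLinearGroup.mem_center_iff]
    constructor
    · rintro ⟨r, -, hr⟩
      rw [eq_one_or_eq_neg_one_iff, ← hr]
      simp
    · rintro (rfl | rfl)
      exacts [⟨1, by simp, by simp⟩, ⟨-1, by simp, by simp [← Matrix.diagonal_one]⟩]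
  rw [toPSL2C, QuotientGroup.mk'_apply, QuotientGroup.mk'_apply, QuotientGroup.eq, hcenter,
    inv_mul_eq_iff_eq_mul, inv_mul_eq_iff_eq_mul, mul_one, mul_neg_one]

theorem toPSL2C_eq_one_iff (a : SL(2, ℂ)) : toPSL2C a = 1 ↔ a = 1 ∨ a = -1 := by
  rw [← map_one toPSL2C, eq_comm, toPSL2C_eq_iff]

theorem toPSL2C_surjective : Function.Surjective toPSL2C :=
  QuotientGroup.mk'_surjective _

section Signs

variable {Y D : Type*} [CommRing D]

/-- The family `g` with the signs of its members changed by `ε`. -/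
def signAct (ε : Y → ℤˣ) (g : Y → SL(2, D)) (y : Y) : SL(2, D) :=
  if ε y = 1 then g y else -g y

theorem signAct_one (g : Y → SL(2, D)) : signAct 1 g = g := by
  ext
  simp [signAct]

theorem signAct_mul (ε δ : Y → ℤˣ) (g : Y → SL(2, D)) :
    signAct (ε * δ) g = signAct ε (signAct δ g) := by
  ext y
  rcases Int.units_eq_one_or (ε y) with hε | hε <;>
    rcases Int.units_eq_one_or (δ y) with hδ | hδ <;>
    simp [signAct, hε, hδ]

theorem toPSL2C_comp_eq_iff {g g' : Y → SL(2, ℂ)} :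
    toPSL2C ∘ g = toPSL2C ∘ g' ↔ ∃ ε, g' = signAct ε g := by
  classical
  simp only [funext_iff, Function.comp_apply, toPSL2C_eq_iff, signAct]
  constructor
  · intro h
    refine ⟨fun y => if g' y = g y then 1 else -1, fun y => ?_⟩
    by_cases hy : g' y = g y
    · simp [hy]
    · simpa [hy] using (h y).resolve_left hy
  · rintro ⟨ε, h⟩ y
    rw [h]
    split_ifs <;> simp

variable (k : Type*) [CommRing k] [Algebra k D]

/-- The endomorphism of the coordinate ring of `SL(2)^Y` that changes signs by `ε`. -/
noncomputable def signChange (ε : Y → ℤˣ) : SLCoordRing k Y →ₐ[k] SLCoordRing k Y :=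
  coordHom k (signAct ε (genericSL k Y))

variable {k}

theorem coordHom_comp_signChange (ε : Y → ℤˣ) (g : Y → SL(2, D)) :
    (coordHom k g).comp (signChange k ε) = coordHom k (signAct ε g) := by
  refine SLCoordRing.algHom_ext fun y i j => ?_
  simp only [AlgHom.comp_apply, signChange, coordHom_genericSL, signAct]
  split_ifs <;> simp

theorem comap_signChange_comap_signChange (ε : Y → ℤˣ) (I : Ideal (SLCoordRing k Y)) :
    (I.comap (signChange k ε)).comap (signChange k ε) = I := by
  have h : (signChange k ε).comp (signChange k ε) = AlgHom.id k (SLCoordRing k Y) := by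
    refine (coordHom_comp_signChange ε (signAct ε (genericSL k Y))).trans ?_
    rw [← signAct_mul, show ε * ε = 1 from funext fun y => Int.units_mul_self _, signAct_one]
    exact SLCoordRing.algHom_ext fun y i j => by simp
  ext f
  exact iff_of_eq (congrArg (· ∈ I) (DFunLike.congr_fun h f))

theorem ker_coordHom_signAct (ε : Y → ℤˣ) (g : Y → SL(2, D)) :
    RingHom.ker (coordHom k (signAct ε g)) =
      (RingHom.ker (coordHom k g)).comap (signChange k ε) := by
  rw [← coordHom_comp_signChange]
  rfl

end Signs

section RepresentationVariety

variable {Y : Type*} {rels : Set (FreeGroup Y)}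

/-- The images of the generators under a representation. -/
def RepVariety.gens (ρ : RepVariety rels) (y : Y) : PSL2C :=
  (show PresentedGroup rels →* PSL2C from ρ) (PresentedGroup.of y)

theorem RepVariety.exists_lift (ρ : RepVariety rels) :
    ∃ g : Y → SL(2, ℂ), toPSL2C ∘ g = ρ.gens :=
  toPSL2C_surjective.comp_left ρ.gens

theorem isProjectiveRep_iff_exists_gens_eq (g : Y → SL(2, ℂ)) :
    IsProjectiveRep rels g ↔ ∃ ρ : RepVariety rels, toPSL2C ∘ g = ρ.gens := by
  have hrels : IsProjectiveRep rels g ↔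
      ∀ w ∈ rels, FreeGroup.lift (toPSL2C ∘ g) w = 1 :=
    forall₂_congr fun w _ => by
      rw [← toPSL2C_eq_one_iff, map_freeGroupLift]
      rfl
  rw [hrels]
  constructor
  · exact fun h => ⟨PresentedGroup.toGroup h, funext fun y => (PresentedGroup.toGroup.of h).symm⟩
  · rintro ⟨ρ, hρ⟩ w hw
    have h : (show PresentedGroup rels →* PSL2C from ρ).comp (PresentedGroup.mk rels) =
        FreeGroup.lift ρ.gens := FreeGroup.lift.symm_apply_eq.mp rfl
    rw [hρ, ← h, MonoidHom.comp_apply, PresentedGroup.one_of_mem hw, map_one]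

/-- The representations that lift to common zeros of the ideal `I`. -/
def repLocus (rels : Set (FreeGroup Y)) (I : Ideal (SLCoordRing ℂ Y)) : Set (RepVariety rels) :=
  {ρ | ∃ g : Y → SL(2, ℂ), I ≤ RingHom.ker (coordHom ℂ g) ∧ toPSL2C ∘ g = ρ.gens}

theorem repLocus_anti {I J : Ideal (SLCoordRing ℂ Y)} (h : I ≤ J) :
    repLocus rels J ⊆ repLocus rels I :=
  fun _ ⟨g, hg, hρ⟩ => ⟨g, h.trans hg, hρ⟩

theorem repLocus_repIdeal : repLocus rels (repIdeal ℂ rels) = Set.univ :=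
  Set.eq_univ_of_forall fun ρ =>
    have ⟨g, hg⟩ := ρ.exists_lift
    ⟨g, (repIdeal_le_ker_coordHom_iff rels g).mpr
      ((isProjectiveRep_iff_exists_gens_eq g).mpr ⟨ρ, hg⟩), hg⟩

theorem RepVariety.exists_gens_eq_of_le_ker {g : Y → SL(2, ℂ)}
    (hg : repIdeal ℂ rels ≤ RingHom.ker (coordHom ℂ g)) :
    ∃ ρ : RepVariety rels, toPSL2C ∘ g = ρ.gens :=
  (isProjectiveRep_iff_exists_gens_eq g).mp ((repIdeal_le_ker_coordHom_iff rels g).mp hg)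

theorem mem_coordinateAlgebraPSL2C_iff (f : (Y → PSL2C) → ℂ) :
    f ∈ coordinateAlgebraPSL2C Y ↔
      ∃ q : SLCoordRing ℂ Y, ∀ g, f (toPSL2C ∘ g) = coordHom ℂ g q :=
  ⟨fun ⟨q, hq⟩ => ⟨Ideal.Quotient.mk _ q, hq⟩,
    fun ⟨q, hq⟩ => (Ideal.Quotient.mk_surjective q).imp fun r hr g => by
      rw [← hr] at hq
      exact hq g⟩

theorem isClosed_zariskiTopology_iff {S : Type*} (O : Subalgebra ℂ (S → ℂ)) (Z : Set S) :
    @IsClosed S (zariskiTopology O) Z ↔ ∃ F ⊆ (O : Set (S → ℂ)), Z = {s | ∀ f ∈ F, f s = 0} := by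
  rw [← @isOpen_compl_iff _ _ (zariskiTopology O)]
  change Zᶜᶜ ∈ _ ↔ _
  rw [compl_compl]
  rfl

theorem RepVariety.isClosed_iff (Z : Set (RepVariety rels)) :
    IsClosed Z ↔ ∃ F ⊆ (coordinateAlgebraPSL2C Y : Set ((Y → PSL2C) → ℂ)),
      Z = {ρ | ∀ f ∈ F, f ρ.gens = 0} := by
  refine (@isClosed_induced_iff _ _ (zariskiTopology (coordinateAlgebraPSL2C Y)) Z
    RepVariety.gens).trans ?_
  simp only [isClosed_zariskiTopology_iff]
  constructor
  · rintro ⟨_, ⟨F, hF, rfl⟩, rfl⟩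
    exact ⟨F, hF, rfl⟩
  · rintro ⟨F, hF, rfl⟩
    exact ⟨_, ⟨F, hF, rfl⟩, rfl⟩

theorem exists_ideal_of_isClosed {C : Set (RepVariety rels)} (hC : IsClosed C) :
    ∃ J : Ideal (SLCoordRing ℂ Y), ∀ (ρ : RepVariety rels) (g : Y → SL(2, ℂ)),
      toPSL2C ∘ g = ρ.gens → (J ≤ RingHom.ker (coordHom ℂ g) ↔ ρ ∈ C) := by
  obtain ⟨F, hF, rfl⟩ := (RepVariety.isClosed_iff C).mp hC
  refine ⟨Ideal.span {q | ∃ f ∈ F, ∀ g, f (toPSL2C ∘ g) = coordHom ℂ g q}, fun ρ g hρ => ?_⟩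
  rw [Ideal.span_le]
  constructor
  · intro h f hf
    obtain ⟨q, hq⟩ := (mem_coordinateAlgebraPSL2C_iff f).mp (hF hf)
    rw [← hρ, hq]
    exact h ⟨f, hf, hq⟩
  · rintro h q ⟨f, hf, hq⟩
    rw [SetLike.mem_coe, RingHom.mem_ker, ← hq, hρ]
    exact h f hf

end RepresentationVariety

section IrreducibleLoci

theorem exists_algHom_apply_ne_zero {k A : Type*} [Field k] [IsAlgClosed k] [CommRing A]
    [Algebra k A] [Algebra.FiniteType k A] {P : Ideal A} (hP : P.IsRadical) {a : A} (ha : a ∉ P) :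
    ∃ φ : A →ₐ[k] k, P ≤ RingHom.ker φ ∧ φ a ≠ 0 := by
  have : IsJacobsonRing A := isJacobsonRing_of_finiteType (A := k)
  obtain ⟨M, ⟨hPM, hM⟩, haM⟩ : ∃ M : Ideal A, (P ≤ M ∧ M.IsMaximal) ∧ a ∉ M := by
    rw [← (isJacobsonRing_iff.mp this) P hP, Ideal.jacobson, Ideal.mem_sInf] at ha
    push Not at ha
    exact ha
  let : Field (A ⧸ M) := Ideal.Quotient.field M
  have : Module.Finite k (A ⧸ M) := finite_of_finite_type_of_isJacobsonRing k (A ⧸ M)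
  let ψ : A ⧸ M →ₐ[k] k := IsAlgClosed.lift
  refine ⟨ψ.comp (Ideal.Quotient.mkₐ k M), fun b hb => ?_, fun h => haM ?_⟩
  · rw [RingHom.mem_ker, AlgHom.comp_apply, Ideal.Quotient.mkₐ_eq_mk,
      Ideal.Quotient.eq_zero_iff_mem.mpr (hPM hb), map_zero]
  · exact Ideal.Quotient.eq_zero_iff_mem.mp ((map_eq_zero_iff ψ ψ.toRingHom.injective).mp h)

variable {Y : Type*} [Finite Y] {rels : Set (FreeGroup Y)}

theorem le_of_forall_le_ker_coordHom {k : Type*} [Field k] [IsAlgClosed k]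
    {P J : Ideal (SLCoordRing k Y)} (hP : P.IsRadical)
    (h : ∀ g : Y → SL(2, k), P ≤ RingHom.ker (coordHom k g) → J ≤ RingHom.ker (coordHom k g)) :
    J ≤ P := by
  intro q hq
  by_contra hqP
  obtain ⟨φ, hφ, hφq⟩ := exists_algHom_apply_ne_zero (k := k) hP hqP
  rw [← coordHom_map_genericSL φ] at hφ hφq
  exact hφq (h _ hφ hq)

theorem exists_mem_coordinateAlgebraPSL2C_eq_zero_iff (q : SLCoordRing ℂ Y) :
    ∃ f ∈ coordinateAlgebraPSL2C Y, ∀ g : Y → SL(2, ℂ),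
      f (toPSL2C ∘ g) = 0 ↔ ∃ ε, coordHom ℂ (signAct ε g) q = 0 := by
  have := Fintype.ofFinite (Y → ℤˣ)
  choose lift hlift using (toPSL2C_surjective.comp_left : Function.Surjective
    fun g : Y → SL(2, ℂ) => toPSL2C ∘ g)
  have hf (g : Y → SL(2, ℂ)) :
      ∏ ε, coordHom ℂ (signAct ε (lift (toPSL2C ∘ g))) q = ∏ ε, coordHom ℂ (signAct ε g) q := by
    obtain ⟨δ, hδ⟩ := toPSL2C_comp_eq_iff.mp (hlift (toPSL2C ∘ g)).symm
    simp only [hδ, ← signAct_mul]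
    exact Equiv.prod_comp (Equiv.mulRight δ) fun ε => coordHom ℂ (signAct ε g) q
  refine ⟨fun p => ∏ ε, coordHom ℂ (signAct ε (lift p)) q, ?_, fun g => ?_⟩
  · refine (mem_coordinateAlgebraPSL2C_iff _).mpr ⟨∏ ε, signChange ℂ ε q, fun g => ?_⟩
    rw [hf, map_prod]
    simp only [← coordHom_comp_signChange, AlgHom.comp_apply]
  · simp only [hf, Finset.prod_eq_zero_iff, Finset.mem_univ, true_and]

theorem isClosed_repLocus (I : Ideal (SLCoordRing ℂ Y)) : IsClosed (repLocus rels I) := by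
  have := Fintype.ofFinite (Y → ℤˣ)
  choose f hf hf0 using exists_mem_coordinateAlgebraPSL2C_eq_zero_iff (Y := Y)
  refine (RepVariety.isClosed_iff _).mpr ⟨f '' I, Set.image_subset_iff.mpr fun q _ => hf q, ?_⟩
  ext ρ
  obtain ⟨g, hg⟩ := ρ.exists_lift
  simp only [Set.forall_mem_image, Set.mem_ofPred_eq, ← hg, hf0]
  have havoid := Ideal.subset_union_prime (s := Finset.univ) (I := I)
    (f := fun ε => RingHom.ker (coordHom ℂ (signAct ε g))) 1 1 fun _ _ _ _ => RingHom.ker_isPrime _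
  simp only [Finset.coe_univ, Set.mem_univ, Set.iUnion_true, Finset.mem_univ, true_and,
    Set.subset_def, Set.mem_iUnion, SetLike.mem_coe, RingHom.mem_ker] at havoid
  refine Iff.trans ?_ havoid.symm
  constructor
  · rintro ⟨g', hg', hρ⟩
    obtain ⟨ε, rfl⟩ := toPSL2C_comp_eq_iff.mp (hg.trans hρ.symm)
    exact ⟨ε, hg'⟩
  · rintro ⟨ε, hε⟩
    exact ⟨signAct ε g, hε, (toPSL2C_comp_eq_iff.mpr ⟨ε, rfl⟩).symm.trans hg⟩

variable {P Q : Ideal (SLCoordRing ℂ Y)}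

theorem isIrreducible_repLocus (hP : P.IsPrime) (hrels : repIdeal ℂ rels ≤ P) :
    IsIrreducible (repLocus rels P) := by
  refine ⟨?_, isPreirreducible_iff_isClosed_union_isClosed.mpr fun C₁ C₂ hC₁ hC₂ hcover => ?_⟩
  · obtain ⟨φ, hφ, -⟩ := exists_algHom_apply_ne_zero (k := ℂ) hP.isRadical
      ((Ideal.ne_top_iff_one P).mp hP.ne_top)
    rw [← coordHom_map_genericSL φ] at hφ
    obtain ⟨ρ, hρ⟩ := RepVariety.exists_gens_eq_of_le_ker (hrels.trans hφ)
    exact ⟨ρ, _, hφ, hρ⟩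
  · obtain ⟨J₁, hJ₁⟩ := exists_ideal_of_isClosed hC₁
    obtain ⟨J₂, hJ₂⟩ := exists_ideal_of_isClosed hC₂
    have hJ : J₁ ⊓ J₂ ≤ P := le_of_forall_le_ker_coordHom hP.isRadical fun g hg => by
      obtain ⟨ρ, hρ⟩ := RepVariety.exists_gens_eq_of_le_ker (hrels.trans hg)
      rcases hcover ⟨g, hg, hρ⟩ with hρC | hρC
      · exact inf_le_left.trans ((hJ₁ ρ g hρ).mpr hρC)
      · exact inf_le_right.trans ((hJ₂ ρ g hρ).mpr hρC)
    refine (hP.inf_le.mp hJ).imp (fun h ρ => ?_) (fun h ρ => ?_) <;> rintro ⟨g, hg, hρ⟩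
    exacts [(hJ₁ ρ g hρ).mp (h.trans hg), (hJ₂ ρ g hρ).mp (h.trans hg)]

theorem exists_comap_signChange_le_of_repLocus_subset (hP : P.IsPrime)
    (hrels : repIdeal ℂ rels ≤ P) (h : repLocus rels P ⊆ repLocus rels Q) :
    ∃ ε, Q.comap (signChange ℂ ε) ≤ P := by
  have := Fintype.ofFinite (Y → ℤˣ)
  have hinf : Finset.univ.inf (fun ε => Q.comap (signChange ℂ ε)) ≤ P :=
    le_of_forall_le_ker_coordHom hP.isRadical fun g hg => by
      obtain ⟨ρ, hρ⟩ := RepVariety.exists_gens_eq_of_le_ker (hrels.trans hg)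
      obtain ⟨g', hg', hρ'⟩ := h ⟨g, hg, hρ⟩
      obtain ⟨ε, rfl⟩ := toPSL2C_comp_eq_iff.mp (hρ.trans hρ'.symm)
      refine (Finset.inf_le (Finset.mem_univ ε)).trans ?_
      rw [ker_coordHom_signAct] at hg'
      simpa only [comap_signChange_comap_signChange] using
        Ideal.comap_mono (f := signChange ℂ ε) hg'
  obtain ⟨ε, -, hε⟩ := hP.inf_le'.mp hinf
  exact ⟨ε, hε⟩

theorem repLocus_ssubset (hP : P.IsPrime) (hrels : repIdeal ℂ rels ≤ P) (h : P < Q) :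
    repLocus rels Q ⊂ repLocus rels P := by
  refine ⟨repLocus_anti h.le, fun hPQ => ?_⟩
  obtain ⟨ε, hε⟩ := exists_comap_signChange_le_of_repLocus_subset hP hrels hPQ
  have hQ := Ideal.comap_mono (f := signChange ℂ ε) hε
  rw [comap_signChange_comap_signChange] at hQ
  exact h.not_ge (hQ.trans ((Ideal.comap_mono h.le).trans hε))

theorem exists_prime_repLocus_eq {I : Ideal (SLCoordRing ℂ Y)} {C : Set (RepVariety rels)}
    (hC : IsClosed C) (hirr : IsIrreducible C) (hCI : C ⊆ repLocus rels I) :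
    ∃ Q : Ideal (SLCoordRing ℂ Y), Q.IsPrime ∧ I ≤ Q ∧ repLocus rels Q = C := by
  classical
  obtain ⟨J, hJ⟩ := exists_ideal_of_isClosed hC
  let mins := ((I ⊔ J).finite_minimalPrimes_of_isNoetherianRing).toFinset
  obtain ⟨_, hQ, hCQ⟩ := isIrreducible_iff_sUnion_isClosed.mp hirr (mins.image (repLocus rels))
    (by simp [isClosed_repLocus]) fun ρ hρ => by
      obtain ⟨g, hg, hgρ⟩ := hCI hρ
      have := RingHom.ker_isPrime (coordHom ℂ g)
      obtain ⟨Q, hQ, hQg⟩ := Ideal.exists_minimalPrimes_le (sup_le hg ((hJ ρ g hgρ).mpr hρ))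
      exact ⟨repLocus rels Q, by simpa [mins] using ⟨Q, hQ, rfl⟩, g, hQg, hgρ⟩
  obtain ⟨Q, hQmins, rfl⟩ := Finset.mem_image.mp hQ
  obtain ⟨⟨hQ, hIJ⟩, -⟩ := (Set.Finite.mem_toFinset _).mp hQmins
  refine ⟨Q, hQ, le_sup_left.trans hIJ, subset_antisymm ?_ hCQ⟩
  rintro ρ ⟨g, hg, hgρ⟩
  exact (hJ ρ g hgρ).mp ((le_sup_right.trans hIJ).trans hg)

/-- The closed irreducible set of representations cut out by a prime ideal containing the
equations of the representation variety. -/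
def irreducibleLocus (P : PrimeSpectrum.zeroLocus (repIdeal ℂ rels : Set (SLCoordRing ℂ Y))) :
    TopologicalSpace.IrreducibleCloseds (RepVariety rels) where
  carrier := repLocus rels P.1.asIdeal
  isIrreducible' := isIrreducible_repLocus P.1.isPrime P.2
  isClosed' := isClosed_repLocus _

theorem height_irreducibleLocus
    (P : PrimeSpectrum.zeroLocus (repIdeal ℂ rels : Set (SLCoordRing ℂ Y))) :
    (Order.height (irreducibleLocus P) : WithBot ℕ∞) =
      ringKrullDim (SLCoordRing ℂ Y ⧸ P.1.asIdeal) := by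
  have hlocus : Order.height (OrderDual.toDual P) = Order.height (irreducibleLocus P) :=
    Order.height_eq_of_strictMono (irreducibleLocus ∘ OrderDual.ofDual)
      (fun Q Q' h => repLocus_ssubset (OrderDual.ofDual Q').1.isPrime (OrderDual.ofDual Q').2 h)
      (fun Q C h => by
        obtain ⟨Q', hQ', hQQ', hC⟩ := exists_prime_repLocus_eq C.isClosed' C.isIrreducible' h.le
        have hne : (OrderDual.ofDual Q).1.asIdeal ≠ Q' := by
          rintro rfl
          exact h.ne (SetLike.coe_injective hC.symm)
        exact ⟨OrderDual.toDual ⟨⟨Q', hQ'⟩, (OrderDual.ofDual Q).2.trans hQQ'⟩,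
          lt_of_le_of_ne hQQ' fun h => hne (congrArg (fun R => R.1.asIdeal) h).symm,
          SetLike.coe_injective hC⟩) _
  have hspec : Order.coheight P = Order.coheight P.1 :=
    Order.coheight_eq_of_strictMono Subtype.val (Subtype.strictMono_coe _)
      (fun Q Q' h => ⟨⟨Q', Set.Subset.trans Q.2 h.le⟩, h, rfl⟩) P
  rw [← hlocus, Order.height_toDual, hspec, Order.coheight_eq_krullDim_Ici, ringKrullDim_quotient]
  rfl

theorem ringKrullDim_quotient_le_topologicalKrullDim (hP : P.IsPrime)
    (hrels : repIdeal ℂ rels ≤ P) :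
    ringKrullDim (SLCoordRing ℂ Y ⧸ P) ≤ topologicalKrullDim (RepVariety rels) :=
  (height_irreducibleLocus ⟨⟨P, hP⟩, hrels⟩).symm.trans_le (Order.height_le_krullDim _)

theorem exists_natCast_le_ringKrullDim_quotient {N : ℕ}
    (hN : (N : WithBot ℕ∞) ≤ topologicalKrullDim (RepVariety rels)) :
    ∃ P : Ideal (SLCoordRing ℂ Y), P.IsPrime ∧ repIdeal ℂ rels ≤ P ∧
      (N : WithBot ℕ∞) ≤ ringKrullDim (SLCoordRing ℂ Y ⧸ P) := by
  obtain ⟨c, rfl⟩ := Order.le_krullDim_iff.mp hN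
  obtain ⟨P, hP, hrels, hc⟩ := exists_prime_repLocus_eq c.last.isClosed' c.last.isIrreducible'
    ((Set.subset_univ _).trans_eq repLocus_repIdeal.symm)
  refine ⟨P, hP, hrels, ?_⟩
  rw [← height_irreducibleLocus ⟨⟨P, hP⟩, hrels⟩,
    show irreducibleLocus ⟨⟨P, hP⟩, hrels⟩ = c.last from SetLike.coe_injective hc]
  exact_mod_cast Order.length_le_height_last

theorem ringKrullDim_quotient_add_one_le_topologicalKrullDim [IrreducibleSpace (RepVariety rels)]
    (hP : P.IsPrime) (hrels : repIdeal ℂ rels ≤ P) (hne : repLocus rels P ≠ Set.univ) :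
    ringKrullDim (SLCoordRing ℂ Y ⧸ P) + 1 ≤ topologicalKrullDim (RepVariety rels) := by
  let whole : TopologicalSpace.IrreducibleCloseds (RepVariety rels) :=
    ⟨Set.univ, IrreducibleSpace.isIrreducible_univ _, isClosed_univ⟩
  have hlt : irreducibleLocus ⟨⟨P, hP⟩, hrels⟩ < whole :=
    lt_of_le_of_ne (Set.subset_univ _) fun h => hne (congrArg SetLike.coe h)
  rw [← height_irreducibleLocus ⟨⟨P, hP⟩, hrels⟩]
  exact (WithBot.coe_le_coe.mpr (Order.height_add_one_le hlt)).trans (Order.height_le_krullDim _)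

end IrreducibleLoci

universe u

section GenericFamilies

/-- The transcendence degree over `k` of the algebra generated by the matrix entries of `g`. -/
noncomputable def entryRank (k : Type*) {Y D : Type*} [Field k] [CommRing D] [IsDomain D]
    [Algebra k D] (g : Y → SL(2, D)) : ℕ∞ :=
  (AlgebraicIndependent.matroid k D).eRk (entrySet g)

variable {Y : Type u} [Finite Y]

theorem ringKrullDim_quotient_ker_coordHom {k D : Type*} [Field k] [CommRing D] [IsDomain D]
    [Algebra k D] (g : Y → SL(2, D)) :
    ringKrullDim (SLCoordRing k Y ⧸ RingHom.ker (coordHom k g)) = entryRank k g := by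
  rw [ringKrullDim_quotient_ker, ← AlgHom.coe_range, range_coordHom, eRk_adjoin, entryRank]

variable {rels : Set (FreeGroup Y)}

section Domain

variable {D : Type*} [CommRing D] [IsDomain D] [Algebra ℂ D] {g : Y → SL(2, D)}

theorem entryRank_le_topologicalKrullDim (hg : IsProjectiveRep rels g) :
    (entryRank ℂ g : WithBot ℕ∞) ≤ topologicalKrullDim (RepVariety rels) := by
  rw [← ringKrullDim_quotient_ker_coordHom]
  exact ringKrullDim_quotient_le_topologicalKrullDim (RingHom.ker_isPrime _)
    ((repIdeal_le_ker_coordHom_iff rels g).mpr hg)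

theorem entryRank_add_one_le_topologicalKrullDim [IrreducibleSpace (RepVariety rels)]
    (hg : IsProjectiveRep rels g) {y : Y} {c : ℂ}
    (hc : (g y 0 0 + g y 1 1) ^ 2 = algebraMap ℂ D c) (hc4 : c ≠ 4) :
    (entryRank ℂ g : WithBot ℕ∞) + 1 ≤ topologicalKrullDim (RepVariety rels) := by
  rw [← ringKrullDim_quotient_ker_coordHom]
  refine ringKrullDim_quotient_add_one_le_topologicalKrullDim (RingHom.ker_isPrime _)
    ((repIdeal_le_ker_coordHom_iff rels g).mpr hg) fun huniv => ?_
  let trivialRep : RepVariety rels := (1 : PresentedGroup rels →* PSL2C)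
  obtain ⟨g₁, hker, hg₁⟩ : trivialRep ∈ repLocus rels (RingHom.ker (coordHom ℂ g)) :=
    huniv ▸ Set.mem_univ _
  let q : SLCoordRing ℂ Y :=
    (genericSL ℂ Y y 0 0 + genericSL ℂ Y y 1 1) ^ 2 - algebraMap ℂ _ c
  have hq : coordHom ℂ g₁ q = 0 := hker (by simp [q, RingHom.mem_ker, hc])
  have htr : (g₁ y 0 0 + g₁ y 1 1) ^ 2 = c := by simpa [q, sub_eq_zero] using hq
  refine hc4 (htr.symm.trans ?_)
  rcases (toPSL2C_eq_one_iff (g₁ y)).mp (congrFun hg₁ y) with h | h <;> rw [h] <;> norm_num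

end Domain

theorem exists_algHom_isAlgClosed_ker_eq {k : Type*} {A : Type u} [CommRing k] [CommRing A]
    [Algebra k A] (P : Ideal A) [P.IsPrime] :
    ∃ (L : Type u) (_ : Field L) (_ : IsAlgClosed L) (_ : Algebra k L) (φ : A →ₐ[k] L),
      RingHom.ker φ = P := by
  refine ⟨AlgebraicClosure P.ResidueField, inferInstance, inferInstance, inferInstance,
    (IsScalarTower.toAlgHom k P.ResidueField (AlgebraicClosure P.ResidueField)).comp
      (IsScalarTower.toAlgHom k A P.ResidueField), ?_⟩
  ext a
  refine (map_eq_zero_iff (algebraMap P.ResidueField (AlgebraicClosure P.ResidueField))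
    (algebraMap P.ResidueField (AlgebraicClosure P.ResidueField)).injective).trans ?_
  exact Ideal.algebraMap_residueField_eq_zero

theorem exists_natCast_le_entryRank {N : ℕ}
    (hN : (N : WithBot ℕ∞) ≤ topologicalKrullDim (RepVariety rels)) :
    ∃ (L : Type u) (_ : Field L) (_ : IsAlgClosed L) (_ : Algebra ℂ L) (g : Y → SL(2, L)),
      IsProjectiveRep rels g ∧ N ≤ entryRank ℂ g := by
  obtain ⟨P, hP, hrels, hN⟩ := exists_natCast_le_ringKrullDim_quotient hN
  obtain ⟨L, _, hL, _, φ, rfl⟩ := exists_algHom_isAlgClosed_ker_eq (k := ℂ) P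
  rw [← coordHom_map_genericSL φ] at hrels hN
  rw [ringKrullDim_quotient_ker_coordHom] at hN
  exact ⟨L, inferInstance, hL, inferInstance, _, (repIdeal_le_ker_coordHom_iff rels _).mp hrels,
    by exact_mod_cast hN⟩

end GenericFamilies

section TwoByTwo

variable {R : Type*} [CommRing R]

theorem mul_self_eq_trace_smul_sub_det_smul_one (M : Matrix (Fin 2) (Fin 2) R) :
    M * M = M.trace • M - M.det • 1 := by
  ext i j
  fin_cases i <;> fin_cases j <;>
    simp [Matrix.mul_apply, Matrix.trace_fin_two, Matrix.det_fin_two] <;> ring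

theorem det_smul_add_smul_one (M : Matrix (Fin 2) (Fin 2) R) (s t : R) :
    (s • M + t • 1).det = s ^ 2 * M.det + s * t * M.trace + t ^ 2 := by
  simp [Matrix.trace_fin_two, Matrix.det_fin_two]
  ring

/-- The one-parameter subgroup `s ↦ s E + s⁻¹ (1 - E)` of `SL(2, R)` attached to a `2 × 2` matrix
`E` of trace `1` and determinant `0`; such a matrix is idempotent. -/
def torus (E : Matrix (Fin 2) (Fin 2) R) (htr : E.trace = 1) (hdet : E.det = 0) :
    Rˣ →* SL(2, R) where
  toFun s := ⟨(s : R) • E + (↑s⁻¹ : R) • (1 - E), by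
    rw [show (s : R) • E + (↑s⁻¹ : R) • (1 - E) = (s - ↑s⁻¹ : R) • E + (↑s⁻¹ : R) • 1 by module,
      det_smul_add_smul_one, htr, hdet]
    linear_combination s.mul_inv⟩
  map_one' := by ext; simp
  map_mul' s t := by
    have hE : E * E = E := by
      rw [mul_self_eq_trace_smul_sub_det_smul_one, htr, hdet, one_smul, zero_smul, sub_zero]
    refine Subtype.ext (Eq.symm ?_)
    calc ((s : R) • E + (↑s⁻¹ : R) • (1 - E)) * ((t : R) • E + (↑t⁻¹ : R) • (1 - E))
        = (s * t : R) • (E * E) + (↑s⁻¹ * ↑t⁻¹ : R) • (1 - E - E + E * E)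
          + (s * ↑t⁻¹ + ↑s⁻¹ * t : R) • (E - E * E) := by
          simp only [add_mul, mul_add, smul_mul_smul_comm, sub_mul, mul_sub, one_mul, mul_one]
          module
      _ = ((s * t : Rˣ) : R) • E + (↑(s * t)⁻¹ : R) • (1 - E) := by
          rw [hE, mul_inv, Units.val_mul, Units.val_mul]
          module

theorem coe_torus {E : Matrix (Fin 2) (Fin 2) R} (htr : E.trace = 1) (hdet : E.det = 0) (s : Rˣ) :
    (torus E htr hdet s).1 = (s : R) • E + (↑s⁻¹ : R) • (1 - E) :=
  rfl

theorem torus_neg_one {E : Matrix (Fin 2) (Fin 2) R} (htr : E.trace = 1) (hdet : E.det = 0) :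
    torus E htr hdet (-1) = -1 := by
  refine Subtype.ext ?_
  rw [coe_torus, inv_neg_one, Units.val_neg, Units.val_one, Matrix.SpecialLinearGroup.coe_neg,
    Matrix.SpecialLinearGroup.coe_one]
  module

/-- The one-parameter subgroup `t ↦ 1 + t N` of `SL(2, R)` attached to a `2 × 2` matrix `N` of
trace and determinant `0`; such a matrix has square `0`. -/
def unipotent (N : Matrix (Fin 2) (Fin 2) R) (htr : N.trace = 0) (hdet : N.det = 0) :
    Multiplicative R →* SL(2, R) where
  toFun t := ⟨t.toAdd • N + 1, by
    rw [← one_smul R (1 : Matrix (Fin 2) (Fin 2) R), det_smul_add_smul_one, htr, hdet]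
    ring⟩
  map_one' := by ext; simp
  map_mul' s t := by
    have hN : N * N = 0 := by
      rw [mul_self_eq_trace_smul_sub_det_smul_one, htr, hdet, zero_smul, zero_smul, sub_zero]
    refine Subtype.ext (Eq.symm ?_)
    calc (s.toAdd • N + 1) * (t.toAdd • N + 1)
        = (s.toAdd * t.toAdd) • (N * N) + (s.toAdd + t.toAdd) • N + 1 := by
          simp only [add_mul, mul_add, smul_mul_smul_comm, one_mul, mul_one]
          module
      _ = (s * t).toAdd • N + 1 := by rw [hN, smul_zero, zero_add, toAdd_mul]

theorem coe_unipotent {N : Matrix (Fin 2) (Fin 2) R} (htr : N.trace = 0) (hdet : N.det = 0)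
    (t : Multiplicative R) : (unipotent N htr hdet t).1 = t.toAdd • N + 1 :=
  rfl

theorem exists_torus_eq (h : SL(2, R)) {a : Rˣ} (ha : IsUnit (a - ↑a⁻¹ : R))
    (htr : h.1.trace = a + ↑a⁻¹) :
    ∃ (E : Matrix (Fin 2) (Fin 2) R) (hE : E.trace = 1) (hdet : E.det = 0),
      torus E hE hdet a = h := by
  obtain ⟨u, hu⟩ := ha
  have huu : (↑u⁻¹ * (a - ↑a⁻¹) : R) = 1 := by rw [← hu, u.inv_mul]
  refine ⟨(↑u⁻¹ : R) • h.1 + (-(↑u⁻¹ * ↑a⁻¹) : R) • 1, ?_, ?_, Subtype.ext ?_⟩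
  · rw [Matrix.trace_add, Matrix.trace_smul, htr, Matrix.trace_smul, Matrix.trace_one,
      Fintype.card_fin, smul_eq_mul, smul_eq_mul]
    push_cast
    linear_combination huu
  · rw [det_smul_add_smul_one, htr, h.det_coe]
    linear_combination (-(↑u⁻¹ : R) ^ 2) * a.mul_inv
  · rw [coe_torus]
    calc _ = (↑u⁻¹ * (a - ↑a⁻¹) : R) • h.1 + (↑a⁻¹ * (1 - ↑u⁻¹ * (a - ↑a⁻¹)) : R) • 1 := by module
      _ = h.1 := by rw [huu, one_smul, sub_self, mul_zero, zero_smul, add_zero]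

theorem exists_pow_eq_of_trace_eq_two {M : SL(2, R)} (htr : M.1.trace = 2) {p : ℕ}
    (hp : IsUnit (p : R)) : ∃ h : SL(2, R), h ^ p = M := by
  obtain ⟨u, hu⟩ := hp
  have hN : (M.1 - 1).trace = 0 := by simp [htr]
  have hdet : (M.1 - 1).det = 0 := by
    rw [show M.1 - 1 = (1 : R) • M.1 + (-1 : R) • 1 by module,
      det_smul_add_smul_one, htr, M.det_coe]
    norm_num
  refine ⟨unipotent _ hN hdet (.ofAdd ↑u⁻¹), Subtype.ext ?_⟩
  rw [← map_pow, ← ofAdd_nsmul, nsmul_eq_mul, ← hu, u.mul_inv, coe_unipotent, toAdd_ofAdd,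
    one_smul, sub_add_cancel]

theorem exists_pow_eq_smul_add_smul_one (h : SL(2, R)) {A : Subring R} (ht : h.1.trace ∈ A)
    (k : ℕ) : ∃ α ∈ A, ∃ β ∈ A, h.1 ^ k = α • h.1 + β • 1 := by
  induction k with
  | zero => exact ⟨0, A.zero_mem, 1, A.one_mem, by simp⟩
  | succ k ih =>
    obtain ⟨α, hα, β, hβ, hk⟩ := ih
    refine ⟨α * h.1.trace + β, A.add_mem (A.mul_mem hα ht) hβ, -α, A.neg_mem hα, ?_⟩
    rw [pow_succ, hk, add_mul, smul_mul_assoc, mul_self_eq_trace_smul_sub_det_smul_one,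
      h.det_coe, one_smul, smul_mul_assoc, one_mul]
    module

theorem trace_pow_eq_add_pow (h : SL(2, R)) {a b : R} (hab : a * b = 1) (ht : a + b = h.1.trace)
    (k : ℕ) : (h.1 ^ k).trace = a ^ k + b ^ k := by
  induction k using Nat.twoStepInduction with
  | zero => simp [one_add_one_eq_two]
  | one => simp [ht]
  | more k ih ih' =>
    rw [pow_add, pow_two, mul_self_eq_trace_smul_sub_det_smul_one, h.det_coe, one_smul, mul_sub,
      mul_smul_comm, ← pow_succ, mul_one, Matrix.trace_sub, Matrix.trace_smul, ih, ih', ← ht,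
      smul_eq_mul]
    linear_combination (a ^ k + b ^ k) * hab

end TwoByTwo

section AlgebraicallyClosed

variable {K : Type*} [Field K] [IsAlgClosed K]

theorem exists_units_add_inv_eq (t : K) : ∃ a : Kˣ, (a + ↑a⁻¹ : K) = t := by
  obtain ⟨a, ha⟩ := IsAlgClosed.exists_root
    (Polynomial.X ^ 2 - Polynomial.C t * Polynomial.X + 1)
    (by rw [show (Polynomial.X ^ 2 - Polynomial.C t * Polynomial.X + 1 :
      Polynomial K).degree = 2 by compute_degree!]; norm_num)
  have hmul : a * (t - a) = 1 := by
    rw [Polynomial.IsRoot.def] at ha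
    simp only [Polynomial.eval_add, Polynomial.eval_sub, Polynomial.eval_mul, Polynomial.eval_pow,
      Polynomial.eval_X, Polynomial.eval_C, Polynomial.eval_one] at ha
    linear_combination -ha
  exact ⟨⟨a, t - a, hmul, by rw [mul_comm, hmul]⟩, add_sub_cancel a t⟩

theorem exists_pow_eq_or_pow_eq_neg (M : SL(2, K)) {p : ℕ} (hp : (p : K) ≠ 0) :
    ∃ h : SL(2, K), h ^ p = M ∨ h ^ p = -M := by
  have hp0 : p ≠ 0 := fun h => hp (by simp [h])
  obtain ⟨a, ha⟩ := exists_units_add_inv_eq M.1.trace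
  by_cases hne : (a - ↑a⁻¹ : K) = 0
  · have hinv : (↑a⁻¹ : K) = a := (sub_eq_zero.mp hne).symm
    have ha2 : (a : K) * a = 1 := by rw [← a.mul_inv, hinv]
    rw [hinv] at ha
    rcases mul_self_eq_one_iff.mp ha2 with ha1 | ha1
    · obtain ⟨h, hh⟩ := exists_pow_eq_of_trace_eq_two (M := M)
        (by rw [← ha, ha1, one_add_one_eq_two]) hp.isUnit
      exact ⟨h, Or.inl hh⟩
    · obtain ⟨h, hh⟩ := exists_pow_eq_of_trace_eq_two (M := -M)
        (by rw [Matrix.SpecialLinearGroup.coe_neg, Matrix.trace_neg, ← ha, ha1]; norm_num)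
        hp.isUnit
      exact ⟨h, Or.inr hh⟩
  · obtain ⟨E, hE, hdet, rfl⟩ := exists_torus_eq M (isUnit_iff_ne_zero.mpr hne) ha.symm
    obtain ⟨c, hc⟩ := IsAlgClosed.exists_pow_nat_eq (a : K) (Nat.pos_of_ne_zero hp0)
    have hc0 : c ≠ 0 := by
      rintro rfl
      exact a.ne_zero (by rw [← hc, zero_pow hp0])
    refine ⟨torus E hE hdet (Units.mk0 c hc0), Or.inl ?_⟩
    rw [← map_pow, show Units.mk0 c hc0 ^ p = a from Units.ext hc]

end AlgebraicallyClosed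

section Algebraicity

variable {B L : Type*} [CommRing B] [IsDomain B] [Field L] [Algebra B L]

open Classical in
/-- A non-zero off-diagonal entry of `h`, if there is one. Together with the diagonal it determines
all entries of `h` up to algebraic dependence. -/
noncomputable def offDiag (h : SL(2, L)) : L :=
  if h 0 1 = 0 then h 1 0 else h 0 1

theorem isAlgebraic_entry {h : SL(2, L)} (h00 : IsAlgebraic B (h 0 0))
    (h11 : IsAlgebraic B (h 1 1)) (hoff : IsAlgebraic B (offDiag h)) (i j : Fin 2) :
    IsAlgebraic B (h i j) := by
  have hdet := h.det_coe
  rw [Matrix.det_fin_two] at hdet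
  have h_anti : IsAlgebraic B (h 0 1) ∧ IsAlgebraic B (h 1 0) := by
    by_cases h01 : h 0 1 = 0
    · exact ⟨h01 ▸ isAlgebraic_zero, by simpa only [offDiag, if_pos h01] using hoff⟩
    · rw [offDiag, if_neg h01] at hoff
      refine ⟨hoff, hoff.of_mul (mem_nonZeroDivisors_of_ne_zero h01) ?_⟩
      rw [show h 0 1 * h 1 0 = h 0 0 * h 1 1 - 1 by linear_combination -hdet]
      exact (h00.mul h11).sub isAlgebraic_one
  fin_cases i <;> fin_cases j
  exacts [h00, h_anti.1, h_anti.2, h11]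

variable [IsAlgClosed L]

theorem isAlgebraic_trace_of_pow {h : SL(2, L)} {p : ℕ} (hp : p ≠ 0)
    (ht : IsAlgebraic B (h ^ p).1.trace) : IsAlgebraic B h.1.trace := by
  obtain ⟨a, ha⟩ := exists_units_add_inv_eq h.1.trace
  let A := Subalgebra.algebraicClosure B L
  have h_int : IsIntegral A ((a : L) ^ p) := by
    refine ⟨Polynomial.X ^ 2 - Polynomial.C (⟨_, ht⟩ : A) * Polynomial.X + Polynomial.C 1,
      by monicity!, ?_⟩
    have hinv : (a : L) ^ p * (↑a⁻¹ : L) ^ p = 1 := by rw [← mul_pow, a.mul_inv, one_pow]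
    have hmem : algebraMap A L ⟨_, ht⟩ = (h ^ p).1.trace := rfl
    simp only [Polynomial.eval₂_add, Polynomial.eval₂_sub, Polynomial.eval₂_mul,
      Polynomial.eval₂_pow, Polynomial.eval₂_X, Polynomial.eval₂_C, Polynomial.eval₂_one, map_one,
      hmem]
    rw [Matrix.SpecialLinearGroup.coe_pow, trace_pow_eq_add_pow h a.mul_inv ha]
    linear_combination -hinv
  have ha_alg : IsAlgebraic B (a : L) :=
    (h_int.isAlgebraic.restrictScalars B).of_pow (Nat.pos_of_ne_zero hp)
  rw [← ha, Units.val_inv_eq_inv_val]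
  exact ha_alg.add ha_alg.inv

theorem isAlgebraic_entry_of_pow {h : SL(2, L)} {p : ℕ} (hp : p ≠ 0)
    (hne : ¬ (h ^ p = 1 ∨ h ^ p = -1)) (hM : ∀ i j, IsAlgebraic B ((h ^ p) i j)) (i j : Fin 2) :
    IsAlgebraic B (h i j) := by
  have ht : IsAlgebraic B h.1.trace := isAlgebraic_trace_of_pow hp (by
    rw [Matrix.trace_fin_two]
    exact (hM 0 0).add (hM 1 1))
  obtain ⟨α, hα, β, hβ, hpow⟩ :=
    exists_pow_eq_smul_add_smul_one h (A := (Subalgebra.algebraicClosure B L).toSubring) ht p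
  have hα0 : α ≠ 0 := by
    rintro rfl
    refine hne ((eq_one_or_eq_neg_one_iff _).mpr ?_)
    simp [hpow]
  have hone : IsAlgebraic B ((1 : Matrix (Fin 2) (Fin 2) L) i j) := by
    rw [Matrix.one_apply]
    split_ifs
    exacts [isAlgebraic_one, isAlgebraic_zero]
  have hij : h i j = α⁻¹ * ((h ^ p) i j - β * (1 : Matrix (Fin 2) (Fin 2) L) i j) := by
    rw [eq_inv_mul_iff_mul_eq₀ hα0, Matrix.SpecialLinearGroup.coe_pow, hpow]
    simp
  rw [hij]
  exact (IsAlgebraic.inv hα).mul ((hM i j).sub (IsAlgebraic.mul hβ hone))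

theorem isAlgebraic_entry_of_pow_eq_one {h : SL(2, L)} {p : ℕ} (hp : p ≠ 0)
    (hpow : h ^ p = 1 ∨ h ^ p = -1) (h00 : IsAlgebraic B (h 0 0))
    (hoff : IsAlgebraic B (offDiag h)) (i j : Fin 2) : IsAlgebraic B (h i j) := by
  have ht : IsAlgebraic B h.1.trace := isAlgebraic_trace_of_pow hp (by
    have h2 : IsAlgebraic B (2 : L) := by simpa using isAlgebraic_natCast (R := B) (A := L) 2
    rcases hpow with e | e
    · simpa [e] using h2
    · simpa [e] using h2.neg)
  refine isAlgebraic_entry h00 ?_ hoff i j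
  simpa [Matrix.trace_fin_two] using ht.sub h00

end Algebraicity

theorem exists_sub_inv_ne_zero_pow_eq_neg_one {p : ℕ} (hp : 1 < p) :
    ∃ ζ : ℂˣ, (ζ - ↑ζ⁻¹ : ℂ) ≠ 0 ∧ ζ ^ p = -1 := by
  have hprim := Complex.isPrimitiveRoot_exp (2 * p) (by omega)
  obtain ⟨ζ, hζ⟩ : IsUnit (Complex.exp (2 * Real.pi * Complex.I / (2 * p : ℕ))) :=
    (Complex.exp_ne_zero _).isUnit
  rw [← hζ] at hprim
  refine ⟨ζ, fun h => hprim.pow_ne_one_of_pos_of_lt two_ne_zero (by omega) ?_, Units.ext ?_⟩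
  · rw [pow_two]
    nth_rewrite 2 [sub_eq_zero.mp h]
    exact ζ.mul_inv
  · exact (hprim.pow (by omega) (mul_comm 2 p)).eq_neg_one_of_two_right

section BigCell

variable {R S : Type*} [CommRing R] [CommRing S]

/-- The family of products of a lower unitriangular, an upper unitriangular and a lower
unitriangular matrix with parameters `v (y, 0)`, `v (y, 1)` and `v (y, 2)`. -/
def bigCell {Y : Type*} (v : Y × Fin 3 → R) (y : Y) : SL(2, R) :=
  ⟨!![1 + v (y, 1) * v (y, 2), v (y, 1);
      v (y, 0) + v (y, 2) + v (y, 0) * v (y, 1) * v (y, 2), 1 + v (y, 0) * v (y, 1)], by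
    rw [Matrix.det_fin_two_of]
    ring⟩

theorem map_bigCell {Y : Type*} (φ : R →+* S) (v : Y × Fin 3 → R) (y : Y) :
    Matrix.SpecialLinearGroup.map φ (bigCell v y) = bigCell (φ ∘ v) y := by
  ext i j
  change φ (bigCell v y i j) = _
  fin_cases i <;> fin_cases j <;> simp [bigCell]

theorem exists_bigCell_eq {K Y : Type*} [Field K] {g : Y → SL(2, K)} (hg : ∀ y, g y 0 1 ≠ 0) :
    ∃ v : Y × Fin 3 → K, bigCell v = g := by
  refine ⟨fun i => ![(g i.1 1 1 - 1) / g i.1 0 1, g i.1 0 1, (g i.1 0 0 - 1) / g i.1 0 1] i.2,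
    funext fun y => ?_⟩
  have hdet := (g y).det_coe
  rw [Matrix.det_fin_two] at hdet
  have h01 := hg y
  ext i j
  fin_cases i <;> fin_cases j <;> simp [bigCell] <;> field_simp <;> grind

variable {k Y : Type*} [Field k]

theorem coordHom_bigCell [Algebra k R] (v : Y × Fin 3 → R) :
    coordHom k (bigCell v) =
      (MvPolynomial.aeval v).comp (coordHom k (bigCell (MvPolynomial.X (R := k)))) := by
  rw [comp_coordHom]
  congr 1
  funext y
  rw [map_bigCell]
  congr 1
  funext i
  simp

theorem ker_coordHom_bigCell_le [Algebra k R] [Algebra k S] {v : Y × Fin 3 → R}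
    (hv : AlgebraicIndependent k v) (w : Y × Fin 3 → S) :
    RingHom.ker (coordHom k (bigCell v)) ≤ RingHom.ker (coordHom k (bigCell w)) := by
  intro q hq
  rw [RingHom.mem_ker, coordHom_bigCell, AlgHom.comp_apply, map_eq_zero_iff _ hv] at hq
  rw [RingHom.mem_ker, coordHom_bigCell, AlgHom.comp_apply, hq, map_zero]

variable {D : Type*} [CommRing D] [IsDomain D] [Algebra k D]

theorem isAlgebraic_adjoin_entrySet (g : Y → SL(2, D)) (y : Y) (i j : Fin 2) :
    IsAlgebraic (Algebra.adjoin k (entrySet g)) (g y i j) :=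
  isAlgebraic_adjoin_of_mem ⟨(y, i, j), rfl⟩

theorem card_le_entryRank_bigCell {v : Y × Fin 3 → D} (hv : AlgebraicIndependent k v) :
    ENat.card (Y × Fin 3) ≤ entryRank k (bigCell v) := by
  rw [← eRk_range_of_algebraicIndependent hv]
  refine eRk_le_eRk_of_isAlgebraic ?_
  rintro _ ⟨⟨y, m⟩, rfl⟩
  have h_entry := isAlgebraic_adjoin_entrySet (k := k) (bigCell v) y
  have hb : v (y, 1) ∈ nonZeroDivisors D := mem_nonZeroDivisors_of_ne_zero (hv.ne_zero _)
  fin_cases m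
  · refine .of_mul hb (h_entry 0 1) ?_
    simpa [bigCell, mul_comm] using (h_entry 1 1).sub isAlgebraic_one
  · exact h_entry 0 1
  · refine .of_mul hb (h_entry 0 1) ?_
    simpa [bigCell] using (h_entry 0 0).sub isAlgebraic_one

end BigCell

section RankBound

variable {k L Y : Type*} [Field k] [Field L] [Algebra k L]

theorem entryRank_le_eRk_range_diag_offDiag (g : Y → SL(2, L)) :
    entryRank k g ≤ (AlgebraicIndependent.matroid k L).eRk
      (Set.range fun i : Y × Fin 3 => ![g i.1 0 0, g i.1 1 1, offDiag (g i.1)] i.2) := by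
  refine eRk_le_eRk_of_isAlgebraic ?_
  rintro _ ⟨⟨y, i, j⟩, rfl⟩
  have h_mem (m : Fin 3) : IsAlgebraic (Algebra.adjoin k (Set.range fun i : Y × Fin 3 =>
      ![g i.1 0 0, g i.1 1 1, offDiag (g i.1)] i.2)) (![g y 0 0, g y 1 1, offDiag (g y)] m) :=
    isAlgebraic_adjoin_of_mem ⟨(y, m), rfl⟩
  exact isAlgebraic_entry (h_mem 0) (h_mem 1) (h_mem 2) i j

theorem entryRank_le_three_mul_card (g : Y → SL(2, L)) :
    entryRank k g ≤ ENat.card (Y × Fin 3) :=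
  (entryRank_le_eRk_range_diag_offDiag g).trans
    (((AlgebraicIndependent.matroid k L).eRk_le_encard _).trans (encard_range_le_card _))

variable [Finite Y] {g : Y → SL(2, L)}

theorem apply_zero_one_ne_zero_of_card_le_entryRank (hg : ENat.card (Y × Fin 3) ≤ entryRank k g)
    (y : Y) : g y 0 1 ≠ 0 := by
  have h_indep := algebraicIndependent_of_card_le_eRk
    (hg.trans (entryRank_le_eRk_range_diag_offDiag g))
  intro h01
  have hdet := (g y).det_coe
  rw [Matrix.det_fin_two, h01, zero_mul, sub_zero] at hdet
  have h_rel : (MvPolynomial.X (y, 0) * MvPolynomial.X (y, 1) : MvPolynomial (Y × Fin 3) k) = 1 :=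
    h_indep (by simp [hdet])
  simpa using congrArg MvPolynomial.constantCoeff h_rel

theorem exists_algebraicIndependent_bigCell_eq (hg : ENat.card (Y × Fin 3) ≤ entryRank k g) :
    ∃ v : Y × Fin 3 → L, AlgebraicIndependent k v ∧ bigCell v = g := by
  obtain ⟨v, rfl⟩ := exists_bigCell_eq (apply_zero_one_ne_zero_of_card_le_entryRank hg)
  refine ⟨v, algebraicIndependent_of_card_le_eRk (hg.trans (eRk_le_eRk_of_isAlgebraic ?_)), rfl⟩
  rintro _ ⟨⟨y, i, j⟩, rfl⟩
  have h_mem (m : Fin 3) : IsAlgebraic (Algebra.adjoin k (Set.range v)) (v (y, m)) :=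
    isAlgebraic_adjoin_of_mem ⟨(y, m), rfl⟩
  fin_cases i <;> fin_cases j
  exacts [isAlgebraic_one.add ((h_mem 1).mul (h_mem 2)), h_mem 1,
    ((h_mem 0).add (h_mem 2)).add (((h_mem 0).mul (h_mem 1)).mul (h_mem 2)),
    isAlgebraic_one.add ((h_mem 0).mul (h_mem 1))]

end RankBound

section FreeWord

open Matrix Polynomial

variable {k : Type*} [Field k]

/-- For `z ≠ w`, the projection of `k²` onto the line of slope `z` along the line of slope `w`. -/
def lineProj (z w : k) : Matrix (Fin 2) (Fin 2) k :=
  (z - w)⁻¹ • vecMulVec ![1, z] ![-w, 1]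

theorem lineProj_add_lineProj {z w : k} (h : z ≠ w) : lineProj z w + lineProj w z = 1 := by
  have hzw : z - w ≠ 0 := sub_ne_zero.mpr h
  have hwz : w - z ≠ 0 := sub_ne_zero.mpr h.symm
  ext i j
  fin_cases i <;> fin_cases j <;> simp [lineProj] <;> field_simp <;> ring

theorem trace_lineProj {z w : k} (h : z ≠ w) : (lineProj z w).trace = 1 := by
  rw [lineProj, trace_smul, trace_vecMulVec, smul_eq_mul, vec2_dotProduct']
  rw [mul_neg, one_mul, mul_one, neg_add_eq_sub, inv_mul_cancel₀ (sub_ne_zero.mpr h)]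

theorem det_lineProj (z w : k) : (lineProj z w).det = 0 := by
  rw [lineProj, det_smul, det_vecMulVec, mul_zero]

variable {Y : Type*}

-- In a reduced word the kernel line of each factor differs from the image line of the next one.
theorem exists_prod_lineProj_eq_vecMulVec (z : Y × Bool ↪ k) {a : Y × Bool}
    {l : List (Y × Bool)} (hl : FreeGroup.IsReduced (a :: l)) :
    ∃ r ≠ 0, ((a :: l).map fun b => lineProj (z b) (z (b.1, !b.2))).prod =
      vecMulVec ![1, z a] r := by
  have h_inv (b : Y × Bool) : (z b - z (b.1, !b.2))⁻¹ ≠ 0 :=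
    inv_ne_zero (sub_ne_zero.mpr (z.injective.ne (by simp [Prod.ext_iff])))
  induction l generalizing a with
  | nil =>
    refine ⟨(z a - z (a.1, !a.2))⁻¹ • ![-z (a.1, !a.2), 1], smul_ne_zero (h_inv a) (by simp), ?_⟩
    rw [List.map_singleton, List.prod_singleton, lineProj, vecMulVec_smul]
  | cons b l ih =>
    rw [FreeGroup.isReduced_cons_cons] at hl
    obtain ⟨r, hr, h_prod⟩ := ih hl.2
    have hba : z b - z (a.1, !a.2) ≠ 0 := by
      refine sub_ne_zero.mpr (z.injective.ne ?_)
      rintro rfl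
      simp at hl
    have h_dot : ![-z (a.1, !a.2), 1] ⬝ᵥ ![1, z b] = z b - z (a.1, !a.2) := by
      rw [vec2_dotProduct']
      ring
    refine ⟨((z a - z (a.1, !a.2))⁻¹ * (z b - z (a.1, !a.2))) • r,
      smul_ne_zero (mul_ne_zero (h_inv a) hba) hr, ?_⟩
    rw [List.map_cons, List.prod_cons, h_prod, lineProj, smul_mul, vecMulVec_mul_vecMulVec,
      h_dot, vecMulVec_smul, mul_smul, vecMulVec_smul, vecMulVec_smul]

variable {A B : Type*} [CommRing A] [Algebra k A] [CommRing B] [Algebra k B]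

/-- The diagonalizable family whose member at `y` has eigenvalue `s` on the line of slope
`z (y, false)` and eigenvalue `s⁻¹` on the line of slope `z (y, true)`. -/
def torusFamily (z : Y × Bool ↪ k) (s : Aˣ) (y : Y) : SL(2, A) :=
  torus ((algebraMap k A).mapMatrix (lineProj (z (y, false)) (z (y, true))))
    (by
      rw [RingHom.mapMatrix_apply, ← AddMonoidHom.map_trace,
        trace_lineProj (z.injective.ne (by simp)), map_one])
    (by rw [← RingHom.map_det, det_lineProj, map_zero]) s

theorem torusFamily_apply_zero_one (z : Y × Bool ↪ k) (s : Aˣ) (y : Y) :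
    torusFamily z s y 0 1 = (s - ↑s⁻¹) * algebraMap k A (z (y, false) - z (y, true))⁻¹ := by
  change ((s : A) • (algebraMap k A).mapMatrix _ + (↑s⁻¹ : A) • (1 - _) : Matrix _ _ A) 0 1 = _
  simp [lineProj, add_mul, sub_eq_add_neg]

/-- The matrix `E + t² (1 - E)`, where `E` is the projection `lineProj` attached to the letter
`a`. It is `t` times a value of `torusFamily`, but makes sense at `t = 0`. -/
def letterPencil (z : Y × Bool ↪ k) (t : A) (a : Y × Bool) : Matrix (Fin 2) (Fin 2) A :=
  (algebraMap k A).mapMatrix (lineProj (z a) (z (a.1, !a.2))) +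
    t ^ 2 • (algebraMap k A).mapMatrix (lineProj (z (a.1, !a.2)) (z a))

theorem mapMatrix_letterPencil (φ : A →ₐ[k] B) (z : Y × Bool ↪ k) (t : A) (a : Y × Bool) :
    φ.mapMatrix (letterPencil z t a) = letterPencil z (φ t) a := by
  ext i j
  simp [letterPencil]

theorem smul_coe_torusFamily (z : Y × Bool ↪ k) (s : Aˣ) (a : Y × Bool) :
    (s : A) • (cond a.2 (torusFamily z s a.1) (torusFamily z s a.1)⁻¹).1 =
      letterPencil z (s : A) a := by
  obtain ⟨y, b⟩ := a
  have h_add := congrArg (algebraMap k A).mapMatrix (lineProj_add_lineProj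
    (z.injective.ne (show (y, false) ≠ (y, true) by simp)))
  rw [map_add, map_one, ← eq_sub_iff_add_eq'] at h_add
  cases b
  · rw [cond_false, torusFamily, ← map_inv, coe_torus, inv_inv, letterPencil, Bool.not_false,
      h_add, smul_add, smul_smul, smul_smul, s.mul_inv, one_smul, sq]
  · rw [cond_true, torusFamily, coe_torus, letterPencil, Bool.not_true, h_add, smul_add, smul_smul,
      smul_smul, s.mul_inv, one_smul, sq, add_comm]

theorem smul_coe_lift_torusFamily (z : Y × Bool ↪ k) (s : Aˣ) (l : List (Y × Bool)) :
    (s : A) ^ l.length • (FreeGroup.lift (torusFamily z s) (FreeGroup.mk l)).1 =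
      (l.map (letterPencil z (s : A))).prod := by
  rw [FreeGroup.lift_mk]
  induction l with
  | nil => simp
  | cons a l ih =>
    rw [List.map_cons, List.prod_cons, List.map_cons, List.prod_cons, ← ih,
      ← smul_coe_torusFamily, Matrix.SpecialLinearGroup.coe_mul, List.length_cons, pow_succ',
      smul_mul_smul_comm]

theorem prod_letterPencil_X_ne_smul_one (z : Y × Bool ↪ k) {l : List (Y × Bool)}
    (hl : FreeGroup.IsReduced l) (h_ne : l ≠ []) {P : k[X]} (hP : P.eval 0 = 0) :
    (l.map (letterPencil z (X : k[X]))).prod ≠ P • 1 := by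
  intro h
  obtain ⟨a, l, rfl⟩ := List.exists_cons_of_ne_nil h_ne
  obtain ⟨r, hr, h_prod⟩ := exists_prod_lineProj_eq_vecMulVec z hl
  have h_letter (b : Y × Bool) :
      (aeval (0 : k)).mapMatrix (letterPencil z (X : k[X]) b) =
        lineProj (z b) (z (b.1, !b.2)) := by
    rw [mapMatrix_letterPencil, aeval_X]
    ext i j
    simp [letterPencil]
  refine vecMulVec_ne_zero (a := ![1, z a]) (by simp) hr ?_
  calc vecMulVec ![1, z a] r
      = (aeval (0 : k)).mapMatrix ((a :: l).map (letterPencil z (X : k[X]))).prod := by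
        rw [map_list_prod, List.map_map, ← h_prod]
        simp only [Function.comp_def, h_letter]
    _ = 0 := by
        rw [h]
        ext i j
        simp [coe_aeval_eq_eval, hP]

theorem not_isProjectiveRep_torusFamily (z : Y × Bool ↪ k) {φ : k[X] →ₐ[k] A}
    (hφ : Function.Injective φ) {s : Aˣ} (hs : s = φ X) {W : FreeGroup Y} (hW : W ≠ 1) :
    ¬ IsProjectiveRep {W} (torusFamily z s) := by
  classical
  intro h
  have h_const : ∃ c : k[X], (FreeGroup.lift (torusFamily z s) W).1 = φ c • 1 := by
    rcases h W rfl with h | h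
    · exact ⟨1, by simp [h]⟩
    · exact ⟨-1, by simp [h]⟩
  obtain ⟨c, hc⟩ := h_const
  refine prod_letterPencil_X_ne_smul_one z FreeGroup.isReduced_toWord
    (FreeGroup.toWord_eq_nil_iff.not.mpr hW) (P := X ^ W.toWord.length * c) ?_
    (Matrix.map_injective hφ ?_)
  · simp [hW]
  calc φ.mapMatrix (W.toWord.map (letterPencil z (X : k[X]))).prod
      = (W.toWord.map (letterPencil z (s : A))).prod := by
        rw [map_list_prod, List.map_map, hs]
        simp only [Function.comp_def, mapMatrix_letterPencil]
    _ = φ X ^ W.toWord.length • φ c • 1 := by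
        rw [← smul_coe_lift_torusFamily, FreeGroup.mk_toWord, hc, hs]
    _ = φ.mapMatrix ((X ^ W.toWord.length * c) • 1) := by
        ext i j
        by_cases hij : i = j <;> simp [hij]

theorem exists_apply_zero_one_ne_zero_not_isProjectiveRep (k : Type*) [Field k] [Infinite k]
    [Finite Y] {W : FreeGroup Y} (hW : W ≠ 1) : ∃ g : Y → SL(2, FractionRing k[X]),
      (∀ y, g y 0 1 ≠ 0) ∧ ¬ IsProjectiveRep {W} g := by
  obtain ⟨n, ⟨e⟩⟩ := Finite.exists_equiv_fin (Y × Bool)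
  set z : Y × Bool ↪ k := (e.toEmbedding.trans Fin.valEmbedding).trans (Infinite.natEmbedding k)
  set φ : k[X] →ₐ[k] FractionRing k[X] := IsScalarTower.toAlgHom k k[X] (FractionRing k[X])
  have hφ : Function.Injective φ := IsFractionRing.injective k[X] (FractionRing k[X])
  have hX : φ X ≠ 0 := (map_ne_zero_iff φ hφ).mpr X_ne_zero
  refine ⟨torusFamily z (Units.mk0 _ hX), fun y => ?_,
    not_isProjectiveRep_torusFamily z hφ rfl hW⟩
  rw [torusFamily_apply_zero_one]
  refine mul_ne_zero (sub_ne_zero.mpr fun h => ?_)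
    ((_root_.map_ne_zero _).mpr (inv_ne_zero (sub_ne_zero.mpr (z.injective.ne (by simp)))))
  have hX2 : (X * X : k[X]) = 1 := hφ <| by
    rw [map_mul, map_one]
    exact (mul_eq_one_iff_eq_inv₀ hX).mpr h
  simpa using congrArg (eval 0) hX2

theorem not_isProjectiveRep_of_card_le_entryRank {L : Type*} [Field L] [Algebra k L] [Infinite k]
    [Finite Y] {W : FreeGroup Y} (hW : W ≠ 1) {g : Y → SL(2, L)}
    (hg : ENat.card (Y × Fin 3) ≤ entryRank k g) : ¬ IsProjectiveRep {W} g := by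
  obtain ⟨v, hv, rfl⟩ := exists_algebraicIndependent_bigCell_eq hg
  obtain ⟨g', hg', hW'⟩ := exists_apply_zero_one_ne_zero_not_isProjectiveRep k hW
  obtain ⟨w, rfl⟩ := exists_bigCell_eq hg'
  rw [← repIdeal_le_ker_coordHom_iff (k := k)] at hW' ⊢
  exact fun h => hW' (h.trans (ker_coordHom_bigCell_le hv w))

end FreeWord

section PinchedFamilies

variable {Y : Type*} {W : FreeGroup Y} {p : ℕ}

theorem isProjectiveRep_singleton_iff {D : Type*} [CommRing D] {g : Y → SL(2, D)} :
    IsProjectiveRep {W} g ↔ FreeGroup.lift g W = 1 ∨ FreeGroup.lift g W = -1 := by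
  simp only [IsProjectiveRep, Set.mem_singleton_iff, forall_eq]

theorem isProjectiveRep_pinchedRelators_iff {D : Type*} [CommRing D] {g : Option Y → SL(2, D)} :
    IsProjectiveRep (pinchedRelators W p) g ↔
      FreeGroup.lift (g ∘ some) W = g none ^ p ∨ FreeGroup.lift (g ∘ some) W = -g none ^ p := by
  have h_some : FreeGroup.lift g (FreeGroup.map some W) = FreeGroup.lift (g ∘ some) W := by
    rw [FreeGroup.map_eq_lift, map_freeGroupLift]
    simp [Function.comp_def]
  rw [pinchedRelators, isProjectiveRep_singleton_iff, map_mul, h_some, map_inv, map_pow,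
    FreeGroup.lift_apply_of, mul_inv_eq_one, mul_inv_eq_iff_eq_mul, neg_one_mul]

variable {k : Type*} [Field k]

theorem entryRank_comp_le {D Y' : Type*} [CommRing D] [IsDomain D] [Algebra k D]
    (g : Y → SL(2, D)) (f : Y' → Y) : entryRank k (g ∘ f) ≤ entryRank k g := by
  refine Matroid.eRk_mono _ ?_
  rintro _ ⟨⟨y, i⟩, rfl⟩
  exact ⟨(f y, i), rfl⟩

variable {L : Type*} [Field L] [IsAlgClosed L] [Algebra k L] {g : Option Y → SL(2, L)}

theorem isProjectiveRep_singleton_iff_pow {D : Type*} [CommRing D] {g : Option Y → SL(2, D)}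
    (hg : IsProjectiveRep (pinchedRelators W p) g) :
    IsProjectiveRep {W} (g ∘ some) ↔ g none ^ p = 1 ∨ g none ^ p = -1 := by
  rw [isProjectiveRep_singleton_iff]
  rcases isProjectiveRep_pinchedRelators_iff.mp hg with h | h
  · rw [h]
  · rw [h, neg_inj, neg_eq_iff_eq_neg, or_comm]

theorem entryRank_le_of_not_isProjectiveRep (hp : p ≠ 0)
    (hg : IsProjectiveRep (pinchedRelators W p) g) (hW : ¬ IsProjectiveRep {W} (g ∘ some)) :
    entryRank k g ≤ entryRank k (g ∘ some) := by
  rw [isProjectiveRep_singleton_iff_pow hg] at hW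
  have h_lift (i j : Fin 2) : IsAlgebraic (Algebra.adjoin k (entrySet (g ∘ some)))
      (FreeGroup.lift (g ∘ some) W i j) := by
    have h_mem : FreeGroup.lift (g ∘ some) W i j ∈ Algebra.adjoin k (entrySet (g ∘ some)) := by
      rw [← range_coordHom, ← coordHom_lift_genericSL (k := k)]
      exact ⟨_, rfl⟩
    exact isAlgebraic_algebraMap (⟨_, h_mem⟩ : Algebra.adjoin k (entrySet (g ∘ some)))
  refine eRk_le_eRk_of_isAlgebraic ?_
  rintro _ ⟨⟨_ | y, i, j⟩, rfl⟩
  · refine isAlgebraic_entry_of_pow hp hW (fun i j => ?_) i j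
    rcases isProjectiveRep_pinchedRelators_iff.mp hg with h | h
    · exact h ▸ h_lift i j
    · simpa [h] using (h_lift i j).neg
  · exact isAlgebraic_adjoin_entrySet (g ∘ some) y i j

theorem entryRank_le_add_two (hp : p ≠ 0) (hg : IsProjectiveRep (pinchedRelators W p) g)
    (hW : IsProjectiveRep {W} (g ∘ some)) : entryRank k g ≤ entryRank k (g ∘ some) + 2 := by
  have h_pow := (isProjectiveRep_singleton_iff_pow hg).mp hW
  calc entryRank k g ≤ (AlgebraicIndependent.matroid k L).eRk
        (entrySet (g ∘ some) ∪ {g none 0 0, offDiag (g none)}) := by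
        refine eRk_le_eRk_of_isAlgebraic ?_
        rintro _ ⟨⟨_ | y, i, j⟩, rfl⟩
        · exact isAlgebraic_entry_of_pow_eq_one hp h_pow (isAlgebraic_adjoin_of_mem (by simp))
            (isAlgebraic_adjoin_of_mem (by simp)) i j
        · exact isAlgebraic_adjoin_of_mem (Or.inl ⟨(y, i, j), rfl⟩)
    _ ≤ entryRank k (g ∘ some) + Set.encard {g none 0 0, offDiag (g none)} :=
        Matroid.eRk_union_le_eRk_add_encard _ _ _
    _ ≤ entryRank k (g ∘ some) + 2 := by
        gcongr
        exact (Set.encard_insert_le _ _).trans_eq (by rw [Set.encard_singleton, one_add_one_eq_two])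

end PinchedFamilies

section RootsOfNegOne

open MvPolynomial

variable {D : Type*} [CommRing D]

/-- The matrices of trace `1` and determinant `0` with kernel spanned by `(-y, 1 - x y)` and image
spanned by `(1, x)`, where `x` and `y` are independent variables. -/
noncomputable def genericProj (D : Type*) [CommRing D] :
    Matrix (Fin 2) (Fin 2) (MvPolynomial (Fin 2) D) :=
  Matrix.vecMulVec ![1, X 0] ![1 - X 0 * X 1, X 1]

theorem trace_genericProj : (genericProj D).trace = 1 := by
  rw [genericProj, Matrix.trace_vecMulVec, Matrix.vec2_dotProduct']
  ring

theorem det_genericProj : (genericProj D).det = 0 := by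
  rw [genericProj, Matrix.det_vecMulVec]

variable [Algebra ℂ D]

/-- The generic conjugate of `diag(ζ, ζ⁻¹)`. -/
noncomputable def genericConj (D : Type*) [CommRing D] [Algebra ℂ D] (ζ : ℂˣ) :
    SL(2, MvPolynomial (Fin 2) D) :=
  torus (genericProj D) trace_genericProj det_genericProj
    (Units.map (algebraMap ℂ (MvPolynomial (Fin 2) D)).toMonoidHom ζ)

theorem genericConj_pow {ζ : ℂˣ} {p : ℕ} (hζ : ζ ^ p = -1) : genericConj D ζ ^ p = -1 := by
  rw [genericConj, ← map_pow, ← map_pow, hζ, ← torus_neg_one trace_genericProj det_genericProj]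
  congr 1
  ext1
  simp

theorem coe_genericConj (ζ : ℂˣ) :
    (genericConj D ζ).1 = (ζ : ℂ) • genericProj D + (↑ζ⁻¹ : ℂ) • (1 - genericProj D) := by
  rw [genericConj, coe_torus, ← map_inv, ← algebraMap_smul (MvPolynomial (Fin 2) D) (ζ : ℂ),
    ← algebraMap_smul (MvPolynomial (Fin 2) D) (↑ζ⁻¹ : ℂ)]
  rfl

theorem trace_genericConj (ζ : ℂˣ) :
    (genericConj D ζ).1.trace = algebraMap ℂ _ (ζ + ↑ζ⁻¹ : ℂ) := by
  rw [coe_genericConj, Matrix.trace_add, Matrix.trace_smul, Matrix.trace_smul, Matrix.trace_sub,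
    trace_genericProj, Matrix.trace_one, Fintype.card_fin, Nat.cast_ofNat,
    show (2 : MvPolynomial (Fin 2) D) - 1 = 1 by norm_num, ← add_smul,
    Algebra.algebraMap_eq_smul_one]

theorem genericConj_zero_one (ζ : ℂˣ) :
    genericConj D ζ 0 1 = algebraMap ℂ _ (ζ - ↑ζ⁻¹ : ℂ) * X 1 := by
  rw [coe_genericConj, map_sub, sub_mul, ← Algebra.smul_def, ← Algebra.smul_def]
  simp [genericProj]
  module

theorem genericConj_zero_zero (ζ : ℂˣ) :
    genericConj D ζ 0 0 = algebraMap ℂ _ (ζ : ℂ) - algebraMap ℂ _ (ζ - ↑ζ⁻¹ : ℂ) * X 1 * X 0 := by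
  rw [coe_genericConj, mul_assoc, mul_comm (X 1), ← Algebra.smul_def,
    Algebra.algebraMap_eq_smul_one]
  simp [genericProj, -Units.val_inv_eq_inv_val]
  module

variable {Y : Type*}

/-- The family `g` together with the generic conjugate of `diag(ζ, ζ⁻¹)` as value at `none`. -/
noncomputable def adjoinGenericConj (ζ : ℂˣ) (g : Y → SL(2, D)) :
    Option Y → SL(2, MvPolynomial (Fin 2) D) :=
  fun o => o.elim (genericConj D ζ) fun y => Matrix.SpecialLinearGroup.map C (g y)

theorem isProjectiveRep_adjoinGenericConj {W : FreeGroup Y} {g : Y → SL(2, D)} {ζ : ℂˣ} {p : ℕ}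
    (hg : IsProjectiveRep {W} g) (hζ : ζ ^ p = -1) :
    IsProjectiveRep (pinchedRelators W p) (adjoinGenericConj ζ g) := by
  have h_lift : FreeGroup.lift (adjoinGenericConj ζ g ∘ some) W =
      Matrix.SpecialLinearGroup.map C (FreeGroup.lift g W) :=
    (map_freeGroupLift _ g W).symm
  have h_pow : adjoinGenericConj ζ g none ^ p = -1 := genericConj_pow hζ
  rw [isProjectiveRep_pinchedRelators_iff, h_lift, h_pow, neg_neg]
  rcases isProjectiveRep_singleton_iff.mp hg with h | h <;> rw [h]
  · exact .inr (map_one _)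
  · exact .inl (Subtype.ext (by simp [Matrix.map_neg, Matrix.map_one C (map_zero C) (map_one C)]))

theorem entryRank_add_two_le [IsDomain D] (g : Y → SL(2, D)) {ζ : ℂˣ}
    (hζ : (ζ - ↑ζ⁻¹ : ℂ) ≠ 0) : entryRank ℂ g + 2 ≤ entryRank ℂ (adjoinGenericConj ζ g) := by
  have h_entry := isAlgebraic_adjoin_entrySet (k := ℂ) (adjoinGenericConj ζ g)
  have h_const (c : ℂ) : IsAlgebraic (Algebra.adjoin ℂ (entrySet (adjoinGenericConj ζ g)))
      (algebraMap ℂ (MvPolynomial (Fin 2) D) c) :=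
    isAlgebraic_algebraMap (algebraMap ℂ (Algebra.adjoin ℂ (entrySet (adjoinGenericConj ζ g))) c)
  have h_ne : algebraMap ℂ (MvPolynomial (Fin 2) D) (ζ - ↑ζ⁻¹ : ℂ) ≠ 0 :=
    (map_ne_zero_iff _ (algebraMap ℂ _).injective).mpr hζ
  have hX1 : IsAlgebraic (Algebra.adjoin ℂ (entrySet (adjoinGenericConj ζ g)))
      (X 1 : MvPolynomial (Fin 2) D) := by
    refine .of_mul (mem_nonZeroDivisors_of_ne_zero h_ne) (h_const _) ?_
    rw [← genericConj_zero_one]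
    exact h_entry none 0 1
  have hX0 : IsAlgebraic (Algebra.adjoin ℂ (entrySet (adjoinGenericConj ζ g)))
      (X 0 : MvPolynomial (Fin 2) D) := by
    refine .of_mul (mem_nonZeroDivisors_of_ne_zero (mul_ne_zero h_ne (X_ne_zero 1)))
      ((h_const _).mul hX1) ?_
    rw [← sub_eq_iff_eq_add'.mpr (sub_eq_iff_eq_add.mp (genericConj_zero_zero ζ).symm)]
    exact (h_const ζ).sub (h_entry none 0 0)
  have h_two : (2 : ℕ∞) = ENat.card (Fin 2) := by simp
  rw [h_two]
  refine (eRk_add_card_le_eRk_image_C_union_range_X (Fin 2) (entrySet g)).trans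
    (eRk_le_eRk_of_isAlgebraic ?_)
  rintro _ (⟨_, ⟨⟨y, i, j⟩, rfl⟩, rfl⟩ | ⟨m, rfl⟩)
  · exact h_entry (some y) i j
  · fin_cases m
    · exact hX0
    · exact hX1

end RootsOfNegOne

section Dimension

variable {X : Type u} [Finite X] {W : FreeGroup X} {p : ℕ}

theorem exists_natCast_eq_topologicalKrullDim (rels : Set (FreeGroup X)) :
    ∃ N : ℕ, topologicalKrullDim (RepVariety rels) = N := by
  have h_nonneg : 0 ≤ topologicalKrullDim (RepVariety rels) := by
    let trivialRep : RepVariety rels := (1 : PresentedGroup rels →* PSL2C)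
    have : Nonempty (TopologicalSpace.IrreducibleCloseds (RepVariety rels)) :=
      ⟨⟨closure {trivialRep}, isIrreducible_singleton.closure, isClosed_closure⟩⟩
    exact Order.krullDim_nonneg
  obtain ⟨d, hd⟩ := WithBot.ne_bot_iff_exists.mp
    (ne_bot_of_le_ne_bot WithBot.zero_ne_bot h_nonneg)
  have h_bound : d ≤ ENat.card (X × Fin 3) := ENat.forall_natCast_le_iff_le.mp fun N hN => by
    have hN' : (N : WithBot ℕ∞) ≤ topologicalKrullDim (RepVariety rels) := by
      rw [← hd]
      exact WithBot.coe_le_coe.mpr hN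
    obtain ⟨L, _, _, _, g, -, hNg⟩ := exists_natCast_le_entryRank hN'
    exact hNg.trans (entryRank_le_three_mul_card g)
  rw [ENat.card_eq_coe_natCard] at h_bound
  obtain ⟨N, rfl⟩ := ENat.ne_top_iff_exists.mp
    (ne_top_of_le_ne_top (ENat.natCast_ne_top _) h_bound)
  exact ⟨N, hd.symm⟩

theorem exists_entryRank_eq_topologicalKrullDim (rels : Set (FreeGroup X)) :
    ∃ (L : Type u) (_ : Field L) (_ : IsAlgClosed L) (_ : Algebra ℂ L) (g : X → SL(2, L)),
      IsProjectiveRep rels g ∧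
        (entryRank ℂ g : WithBot ℕ∞) = topologicalKrullDim (RepVariety rels) := by
  obtain ⟨N, hN⟩ := exists_natCast_eq_topologicalKrullDim rels
  obtain ⟨L, _, hL, _, g, hg, hNg⟩ := exists_natCast_le_entryRank hN.ge
  exact ⟨L, inferInstance, hL, inferInstance, g, hg,
    (entryRank_le_topologicalKrullDim hg).antisymm (hN ▸ WithBot.coe_le_coe.mpr hNg)⟩

theorem card_le_topologicalKrullDim_pinchedRelators (hp : p ≠ 0) (W : FreeGroup X) :
    (ENat.card (X × Fin 3) : WithBot ℕ∞) ≤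
      topologicalKrullDim (RepVariety (pinchedRelators W p)) := by
  obtain ⟨L, _, _, _, φ, hφ⟩ :=
    exists_algHom_isAlgClosed_ker_eq (k := ℂ) (⊥ : Ideal (MvPolynomial (X × Fin 3) ℂ))
  have : CharZero L := charZero_of_injective_algebraMap (algebraMap ℂ L).injective
  have hv : AlgebraicIndependent ℂ (φ ∘ MvPolynomial.X) :=
    (MvPolynomial.algebraicIndependent_X (X × Fin 3) ℂ).map'
      ((RingHom.injective_iff_ker_eq_bot _).mpr hφ)
  obtain ⟨h, hh⟩ := exists_pow_eq_or_pow_eq_neg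
    (FreeGroup.lift (bigCell (φ ∘ MvPolynomial.X)) W) (Nat.cast_ne_zero.mpr hp)
  let g : Option X → SL(2, L) := fun o => o.elim h (bigCell (φ ∘ MvPolynomial.X))
  have hg : IsProjectiveRep (pinchedRelators W p) g :=
    isProjectiveRep_pinchedRelators_iff.mpr <|
      hh.imp Eq.symm fun h_neg => (neg_eq_iff_eq_neg.mpr h_neg).symm
  exact (WithBot.coe_le_coe.mpr <| (card_le_entryRank_bigCell hv).trans <|
    entryRank_comp_le g some).trans (entryRank_le_topologicalKrullDim hg)

theorem topologicalKrullDim_add_two_le_pinchedRelators (hp : 1 < p) (W : FreeGroup X) :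
    topologicalKrullDim (RepVariety {W}) + 2 ≤
      topologicalKrullDim (RepVariety (pinchedRelators W p)) := by
  obtain ⟨L, _, _, _, g, hg, hdim⟩ := exists_entryRank_eq_topologicalKrullDim {W}
  obtain ⟨ζ, hζ, hζp⟩ := exists_sub_inv_ne_zero_pow_eq_neg_one hp
  rw [← hdim]
  exact (WithBot.coe_le_coe.mpr (entryRank_add_two_le g hζ)).trans
    (entryRank_le_topologicalKrullDim (isProjectiveRep_adjoinGenericConj hg hζp))

theorem topologicalKrullDim_add_two_add_one_le_pinchedRelators (hp : 1 < p) (W : FreeGroup X)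
    [IrreducibleSpace (RepVariety (pinchedRelators W p))] :
    topologicalKrullDim (RepVariety {W}) + 2 + 1 ≤
      topologicalKrullDim (RepVariety (pinchedRelators W p)) := by
  obtain ⟨L, _, _, _, g, hg, hdim⟩ := exists_entryRank_eq_topologicalKrullDim {W}
  obtain ⟨ζ, hζ, hζp⟩ := exists_sub_inv_ne_zero_pow_eq_neg_one hp
  have h_trace : (adjoinGenericConj ζ g none 0 0 + adjoinGenericConj ζ g none 1 1) ^ 2 =
      algebraMap ℂ _ ((ζ + ↑ζ⁻¹) ^ 2) := by
    rw [map_pow, ← trace_genericConj, Matrix.trace_fin_two]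
    rfl
  have h_ne : (ζ + ↑ζ⁻¹ : ℂ) ^ 2 ≠ 4 := fun h =>
    pow_ne_zero 2 hζ (by linear_combination h - 4 * ζ.mul_inv)
  rw [← hdim]
  refine le_trans ?_ (entryRank_add_one_le_topologicalKrullDim
    (isProjectiveRep_adjoinGenericConj hg hζp) h_trace h_ne)
  gcongr
  exact WithBot.coe_le_coe.mpr (entryRank_add_two_le g hζ)

theorem topologicalKrullDim_pinchedRelators_le (hp : p ≠ 0) (W : FreeGroup X) :
    topologicalKrullDim (RepVariety (pinchedRelators W p)) ≤
      max (ENat.card (X × Fin 3) : WithBot ℕ∞) (topologicalKrullDim (RepVariety {W}) + 2) := by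
  obtain ⟨L, _, _, _, g, hg, hdim⟩ :=
    exists_entryRank_eq_topologicalKrullDim (pinchedRelators W p)
  rw [← hdim]
  by_cases hW : IsProjectiveRep {W} (g ∘ some)
  · refine le_max_of_le_right ((WithBot.coe_le_coe.mpr (entryRank_le_add_two hp hg hW)).trans ?_)
    rw [WithBot.coe_add]
    exact add_le_add_left (entryRank_le_topologicalKrullDim hW) _
  · exact le_max_of_le_left <| WithBot.coe_le_coe.mpr <|
      (entryRank_le_of_not_isProjectiveRep hp hg hW).trans (entryRank_le_three_mul_card _)

theorem topologicalKrullDim_repVariety_lt (hW : W ≠ 1) :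
    topologicalKrullDim (RepVariety {W}) < ENat.card (X × Fin 3) := by
  obtain ⟨L, _, _, _, g, hg, hdim⟩ := exists_entryRank_eq_topologicalKrullDim {W}
  rw [← hdim, WithBot.coe_lt_coe]
  exact not_le.mp fun h => not_isProjectiveRep_of_card_le_entryRank hW h hg

end Dimension

theorem theoremC {X : Type*} [Fintype X] (n : ℕ) (hn : Fintype.card X = n)
    (p : ℕ) (hp : 1 < p) (W : FreeGroup X) (hW : W ≠ 1) :
    (topologicalKrullDim (RepVariety (pinchedRelators W p)) =
        max ((3 * n : ℕ) : WithBot ℕ∞) (topologicalKrullDim (RepVariety {W}) + 2) ∧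
      max ((3 * n : ℕ) : WithBot ℕ∞) (topologicalKrullDim (RepVariety {W}) + 2) ≤
        ((3 * n + 1 : ℕ) : WithBot ℕ∞)) ∧
    (((3 * n : ℕ) : WithBot ℕ∞) ≤ topologicalKrullDim (RepVariety {W}) + 2 →
      ¬ PreirreducibleSpace (RepVariety (pinchedRelators W p))) := by
  have h_card : (ENat.card (X × Fin 3) : WithBot ℕ∞) = (3 * n : ℕ) := by
    rw [ENat.card_eq_coe_fintype_card, Fintype.card_prod, hn, Fintype.card_fin, mul_comm]
    rfl
  have hp0 : p ≠ 0 := by omega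
  obtain ⟨e, he⟩ := exists_natCast_eq_topologicalKrullDim {W}
  have h_dim := le_antisymm (topologicalKrullDim_pinchedRelators_le hp0 W) <|
    max_le (card_le_topologicalKrullDim_pinchedRelators hp0 W)
      (topologicalKrullDim_add_two_le_pinchedRelators hp W)
  have h_lt := topologicalKrullDim_repVariety_lt hW
  rw [h_card, he] at h_dim h_lt
  norm_cast at h_lt
  rw [he]
  refine ⟨⟨h_dim, max_le (by norm_cast; omega) (by norm_cast; omega)⟩,
    fun h_ge h_irr => ?_⟩
  have : IrreducibleSpace (RepVariety (pinchedRelators W p)) :=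
    ⟨⟨(1 : PresentedGroup (pinchedRelators W p) →* PSL2C)⟩⟩
  have h_succ := topologicalKrullDim_add_two_add_one_le_pinchedRelators hp W
  rw [he, h_dim, max_eq_right h_ge] at h_succ
  norm_cast at h_succ
  omega
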